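/- Let $M$ and $N$ be smooth, Hausdorff, second countable manifolds (finite-dimensional, without boundary) and let $I=(0,1]$. A net $(u_\varepsilon)_{\varepsilon\in I}$ of smooth maps $u_\varepsilon:M\to N$ is called * *c-bounded* if for every compact $K\subseteq M$ there are $\varepsilon_0>0$ and a compact $K'\subseteq N$ with $u_\varepsilon(K)\subseteq K'$ for all $\varepsilon<\varepsilon_0$; * *moderate* if for every $k\in\mathbb N_0$, all charts $(V,\varphi)$ of $M$ and $(W,\psi)$ of $N$, and all compact $L\subseteq V$, $L'\subseteq W$ there is $p\in\mathbb N$ with $$\sup_{x\in L\cap u_\varepsilon^{-1}(L')}\|D^{(k)}(\psi\circ u_\varepsilon\circ\varphi^{-1})(\varphi(x))\|=O(\varepsilon^{-p})\qquad(\varepsilon\to0).$$ Let $\mathcal E_{M,co}[M,N]$ be the set of all c-bounded moderate nets for which $(\varepsilon,x)\mapsto u_\varepsilon(x)$ is continuous in $\varepsilon$ and smooth in $x$ (that is, $\varepsilon\mapsto u_\varepsilon(x)$ is continuous on $I$ for each $x\in M$, and each $u_\varepsilon$ is smooth), and let $\mathcal E_{M,sm}[M,N]$ be the set of those for which $(\varepsilon,x)\mapsto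 u_\varepsilon(x)$ is smooth on $I\times M$. Two such nets are equivalent, $(u_\varepsilon)_\varepsilon\sim(v_\varepsilon)_\varepsilon$, if * for some (equivalently, every) Riemannian metric $h$ on $N$, with Riemannian distance $d_h$, one has $\sup_{x\in K}d_h(u_\varepsilon(x),v_\varepsilon(x))\to0$ as $\varepsilon\to0$ for every compact $K\subseteq M$; and * for all $k,q\in\mathbb N_0$, all charts $(V,\varphi)$ of $M$ and $(W,\psi)$ of $N$, and all compact $L\subseteq V$, $L'\subseteq W$, $$\sup_{x\in L\cap u_\varepsilon^{-1}(L')\cap v_\varepsilon^{-1}(L')}\|D^{(k)}(\psi\circ u_\varepsilon\circ\varphi^{-1}-\psi\circ v_\varepsilon\circ\varphi^{-1})(\varphi(x))\|=O(\varepsilon^{q})\qquad(\varepsilon\to0).$$ Put $\mathcal G_{co}[M,N]=\mathcal E_{M,co}[M,N]/{\sim}$ and $\mathcal G_{sm}[M,N]=\mathcal E_{M,sm}[M,N]/{\sim}$. Then the natural map $$\tau_{sm}:\mathcal G_{sm}[M,N]\to\mathcal G_{co}[M,N],\qquad [(u_\varepsilon)_\varepsilon]\mapsto[(u_\varepsilon)_\varepsilon],$$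 is bijective. -/

import Mathlib

open scoped Manifold ContDiff Topology ENNReal

namespace GenFun

section RiemannianMetrics

open Set Bundle

theorem contMDiffOn_trivialization_symm_const {n : ℕ} {N : Type*} [TopologicalSpace N]
    [ChartedSpace (EuclideanSpace ℝ (Fin n)) N] [IsManifold (𝓡 n) ∞ N]
    {F : Type*} [NormedAddCommGroup F] [NormedSpace ℝ F] (V : N → Type*)
    [TopologicalSpace (TotalSpace F V)] [∀ x, AddCommGroup (V x)] [∀ x, TopologicalSpace (V x)]
    [∀ x, Module ℝ (V x)]
    [FiberBundle F V] [VectorBundle ℝ F V] [ContMDiffVectorBundle ∞ F V (𝓡 n)] (x₀ : N) (c : F) :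
    ContMDiffOn (𝓡 n) ((𝓡 n).prod 𝓘(ℝ, F)) ∞
      (fun y => TotalSpace.mk' F y ((trivializationAt F V x₀).symm y c))
      (trivializationAt F V x₀).baseSet := by
  rw [(trivializationAt F V x₀).contMDiffOn_section_baseSet_iff]
  apply (contMDiffOn_const (c := c)).congr
  intro y hy
  rw [(trivializationAt F V x₀).apply_mk_symm hy]

set_option synthInstance.maxHeartbeats 400000 in
set_option maxHeartbeats 1000000 in
theorem exists_posDef_section {n : ℕ} {N : Type*} [TopologicalSpace N]
    [ChartedSpace (EuclideanSpace ℝ (Fin n)) N] [IsManifold (𝓡 n) ∞ N]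
    [T2Space N] [SigmaCompactSpace N]
    {F : Type*} [NormedAddCommGroup F] [InnerProductSpace ℝ F] (V : N → Type*)
    [TopologicalSpace (TotalSpace F V)] [∀ x, AddCommGroup (V x)] [∀ x, TopologicalSpace (V x)]
    [∀ x, IsTopologicalAddGroup (V x)] [∀ x, Module ℝ (V x)] [∀ x, ContinuousSMul ℝ (V x)]
    [FiberBundle F V] [VectorBundle ℝ F V] [ContMDiffVectorBundle ∞ F V (𝓡 n)] :
    ∃ s : (x : N) → V x →L[ℝ] V x →L[ℝ] ℝ,
      ContMDiff (𝓡 n) ((𝓡 n).prod 𝓘(ℝ, F →L[ℝ] F →L[ℝ] ℝ)) ∞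
        (fun b ↦ TotalSpace.mk' (F →L[ℝ] F →L[ℝ] ℝ) b (s b)) ∧
      ∀ x, (∀ v w, s x v w = s x w v) ∧ ∀ v, v ≠ 0 → 0 < s x v v := by
  obtain ⟨s, hs⟩ := exists_contMDiffSection_forall_mem_convex_of_local (n := ⊤) (𝓡 n)
    (F_fiber := F →L[ℝ] F →L[ℝ] ℝ)
    (fun x : N => V x →L[ℝ] V x →L[ℝ] ℝ)
    (fun x => {g | (∀ v w, g v w = g w v) ∧ ∀ v, v ≠ 0 → 0 < g v v})
    (by
      rintro x g ⟨hg1, hg2⟩ g' ⟨hg1', hg2'⟩ a b ha hb hab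
      refine ⟨fun v w => ?_, fun v hv => ?_⟩
      · simp [hg1 v w, hg1' v w]
      · have := hg2 v hv
        have := hg2' v hv
        simp only [add_apply, smul_apply, smul_eq_mul]
        rcases ha.eq_or_lt with rfl | ha'
        · have : b = 1 := by linarith
          subst this; simpa
        · positivity)
    (by
      intro x₀
      let e := trivializationAt F V x₀
      let e' := trivializationAt (F →L[ℝ] F →L[ℝ] ℝ)
        (fun x : N => V x →L[ℝ] V x →L[ℝ] ℝ) x₀
      have hb : e'.baseSet ⊆ e.baseSet := by
        intro y hy
        simpa [e', e] using hy
      refine ⟨e'.baseSet, e'.open_baseSet.mem_nhds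
        (FiberBundle.mem_baseSet_trivializationAt' x₀),
        fun y => e'.symm y (innerSL ℝ (E := F)), ?_, ?_⟩
      · exact contMDiffOn_trivialization_symm_const (F := F →L[ℝ] F →L[ℝ] ℝ)
          (fun x : N => V x →L[ℝ] V x →L[ℝ] ℝ) x₀ (innerSL ℝ (E := F))
      · intro y hy
        have key : ∀ v w : V y, e'.symm y (innerSL ℝ (E := F)) v w
            = inner ℝ (e.linearMapAt ℝ y v) (e.linearMapAt ℝ y w) := by
          intro v w
          have h1 : (e' ⟨y, e'.symm y (innerSL ℝ (E := F))⟩).2 = innerSL ℝ (E := F) := by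
            rw [e'.apply_mk_symm hy]
          have h2 := DFunLike.congr_fun (DFunLike.congr_fun h1 (e.linearMapAt ℝ y v))
            (e.linearMapAt ℝ y w)
          simp only [e', hom_trivializationAt_apply] at h2
          rw [inCoordinates_apply_eq₂ (hb hy) (hb hy) (mem_univ _)] at h2
          have A : ∀ v : V y, e.symm y (e.linearMapAt ℝ y v) = v := by
            intro v
            have := e.symmₗ_linearMapAt (R := ℝ) (hb hy) v
            rwa [Trivialization.symmₗ_apply _ (hb hy)] at this
          simp only [e] at A
          simp only [e, A] at h2
          rw [innerSL_apply_apply] at h2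
          simpa only [Trivial.fiberBundle_trivializationAt', Trivial.linearMapAt_trivialization,
            LinearMap.id_coe, id_eq] using h2
        refine ⟨fun v w => ?_, fun v hv => ?_⟩
        · rw [key, key, real_inner_comm]
        · rw [key, real_inner_self_pos]
          intro h0
          apply hv
          have := e.symmₗ_linearMapAt (R := ℝ) (hb hy) v
          rw [h0, map_zero] at this
          exact this.symm)
  exact ⟨s, s.contMDiff, hs⟩

theorem exists_posDef_lower_bound {n : ℕ}
    (g : EuclideanSpace ℝ (Fin n) →L[ℝ] EuclideanSpace ℝ (Fin n) →L[ℝ] ℝ)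
    (hg : ∀ v, v ≠ 0 → 0 < g v v) :
    ∃ c : ℝ, 0 < c ∧ ∀ v, c * ‖v‖ ^ 2 ≤ g v v := by
  have hcont : Continuous fun v => g v v := g.continuous.clm_apply continuous_id
  rcases (Metric.sphere (0 : EuclideanSpace ℝ (Fin n)) 1).eq_empty_or_nonempty with h | h
  · refine ⟨1, one_pos, fun v => ?_⟩
    have hv : v = 0 := by
      by_contra hv
      have : (‖v‖⁻¹ : ℝ) • v ∈ Metric.sphere (0 : EuclideanSpace ℝ (Fin n)) 1 := by
        simp [norm_smul, hv]
      simp [h] at this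
    simp [hv]
  · obtain ⟨w, hw, hmin⟩ := (isCompact_sphere (0 : EuclideanSpace ℝ (Fin n)) 1).exists_isMinOn h
      hcont.continuousOn
    have hw0 : w ≠ 0 := by
      rintro rfl
      simp at hw
    refine ⟨g w w, hg w hw0, fun v => ?_⟩
    by_cases hv : v = 0
    · simp [hv]
    have hmem : (‖v‖⁻¹ : ℝ) • v ∈ Metric.sphere (0 : EuclideanSpace ℝ (Fin n)) 1 := by
      simp [norm_smul, hv]
    have h1 : g w w ≤ g ((‖v‖⁻¹ : ℝ) • v) ((‖v‖⁻¹ : ℝ) • v) := hmin hmem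
    simp only [map_smul, smul_apply, smul_eq_mul] at h1
    have hpos : 0 < ‖v‖ := norm_pos_iff.2 hv
    calc g w w * ‖v‖ ^ 2 ≤ (‖v‖⁻¹ * (‖v‖⁻¹ * g v v)) * ‖v‖ ^ 2 := by gcongr
      _ = g v v := by field_simp

theorem isVonNBounded_of_posDef {n : ℕ}
    (g : EuclideanSpace ℝ (Fin n) →L[ℝ] EuclideanSpace ℝ (Fin n) →L[ℝ] ℝ)
    (hg : ∀ v, v ≠ 0 → 0 < g v v) :
    Bornology.IsVonNBounded ℝ {v | g v v < 1} := by
  obtain ⟨c, hc, h⟩ := exists_posDef_lower_bound g hg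
  rw [NormedSpace.isVonNBounded_iff]
  refine (Metric.isBounded_ball (x := (0 : EuclideanSpace ℝ (Fin n)))
    (r := 1 + c⁻¹)).subset fun v hv => ?_
  have h1 : c * ‖v‖ ^ 2 < 1 := (h v).trans_lt hv
  have h2 : ‖v‖ ^ 2 < c⁻¹ := by
    rw [← one_div, lt_div_iff₀ hc]; linarith
  simp only [Metric.mem_ball, dist_zero_right]
  nlinarith [norm_nonneg v]

/-- Smooth Riemannian metrics on an `n`-dimensional manifold `N`. -/
abbrev SmoothMetric (n : ℕ) (N : Type*) [TopologicalSpace N]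
    [ChartedSpace (EuclideanSpace ℝ (Fin n)) N] [IsManifold (𝓡 n) ∞ N] :=
  ContMDiffRiemannianMetric (𝓡 n) ∞ (EuclideanSpace ℝ (Fin n))
    (fun x : N => TangentSpace (𝓡 n) x)

/-- The Riemannian distance `d_h`: the infimum of the `h`-lengths of `C¹` paths joining two points
(`∞` for points in different connected components). -/
noncomputable def riemDist {n : ℕ} {N : Type*} [TopologicalSpace N]
    [ChartedSpace (EuclideanSpace ℝ (Fin n)) N] [IsManifold (𝓡 n) ∞ N]
    (h : SmoothMetric n N) (p q : N) : ℝ≥0∞ :=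
  letI : RiemannianBundle (fun x : N => TangentSpace (𝓡 n) x) := ⟨h.toRiemannianMetric⟩
  Manifold.riemannianEDist (𝓡 n) p q

theorem nonempty_smoothMetric (n : ℕ) (N : Type*) [TopologicalSpace N]
    [ChartedSpace (EuclideanSpace ℝ (Fin n)) N] [IsManifold (𝓡 n) ∞ N]
    [T2Space N] [SecondCountableTopology N] : Nonempty (SmoothMetric n N) := by
  have := Manifold.locallyCompact_of_finiteDimensional (M := N) (𝓡 n)
  have : SigmaCompactSpace N := inferInstance
  obtain ⟨s, hs, h⟩ := exists_posDef_section (n := n) (N := N)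
    (F := EuclideanSpace ℝ (Fin n)) (fun x : N => TangentSpace (𝓡 n) x)
  exact ⟨⟨s, fun x => (h x).1, fun x => (h x).2,
    fun x => isVonNBounded_of_posDef (s x) (h x).2, hs⟩⟩

theorem riemDist_spec {n : ℕ} {N : Type*} [TopologicalSpace N]
    [ChartedSpace (EuclideanSpace ℝ (Fin n)) N] [IsManifold (𝓡 n) ∞ N] [T2Space N]
    (h : SmoothMetric n N) :
    (Continuous fun z : N × N => riemDist h z.1 z.2) ∧ (∀ p, riemDist h p p = 0) ∧
      (∀ p q, riemDist h p q = 0 → p = q) ∧ ∀ p q, riemDist h p q = riemDist h q p := by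
  have := Manifold.locallyCompact_of_finiteDimensional (M := N) (𝓡 n)
  let : RiemannianBundle (fun x : N => TangentSpace (𝓡 n) x) := ⟨h.toRiemannianMetric⟩
  have : IsContinuousRiemannianBundle (EuclideanSpace ℝ (Fin n))
      (fun x : N => TangentSpace (𝓡 n) x) :=
    ⟨⟨h.inner, h.contMDiff.continuous, fun _ _ _ => rfl⟩⟩
  let d : EMetricSpace N := EMetricSpace.ofRiemannianMetric (𝓡 n) N
  have hd : ∀ p q, riemDist h p q = edist p q := fun p q => rfl
  exact ⟨continuous_edist (α := N), fun p => (hd p p).trans (edist_self p),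
    fun p q hpq => eq_of_edist_eq_zero ((hd p q).symm.trans hpq), fun p q => by
      rw [hd, hd, edist_comm]⟩

theorem riemDist_triangle {n : ℕ} {N : Type*} [TopologicalSpace N]
    [ChartedSpace (EuclideanSpace ℝ (Fin n)) N] [IsManifold (𝓡 n) ∞ N]
    (h : SmoothMetric n N) (p q r : N) :
    riemDist h p r ≤ riemDist h p q + riemDist h q r := by
  let : RiemannianBundle (fun x : N => TangentSpace (𝓡 n) x) := ⟨h.toRiemannianMetric⟩
  exact Manifold.riemannianEDist_triangle

end RiemannianMetrics

section Nets

open Set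

/-- The parameter interval `I = (0,1]`. -/
abbrev Param : Type := Set.Ioc (0 : ℝ) 1

/-- Retraction of `ℝ` onto `(0,1]`, used only to evaluate a net at a real `ε ∈ (0,1]`. -/
noncomputable def toParam (t : ℝ) : Param :=
  if h : t ∈ Set.Ioc (0 : ℝ) 1 then ⟨t, h⟩ else ⟨1, one_pos, le_rfl⟩

/-- c-boundedness: `∀ K ⊂⊂ M ∃ ε₀ > 0 ∃ K' ⊂⊂ N ∀ ε < ε₀, u_ε(K) ⊆ K'`. -/
def IsCBounded {M N : Type*} [TopologicalSpace M] [TopologicalSpace N]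
    (u : Param → M → N) : Prop :=
  ∀ K : Set M, IsCompact K → ∃ ε₀ : ℝ, 0 < ε₀ ∧ ∃ K' : Set N, IsCompact K' ∧
    ∀ ε : Param, (ε : ℝ) < ε₀ → ∀ x ∈ K, u ε x ∈ K'

/-- `sup_{x ∈ K} d_h(u_ε(x), v_ε(x)) → 0` as `ε → 0`, for every `K ⊂⊂ M`. -/
def UnifClose {n : ℕ} {M N : Type*} [TopologicalSpace M] [TopologicalSpace N]
    [ChartedSpace (EuclideanSpace ℝ (Fin n)) N] [IsManifold (𝓡 n) ∞ N]
    (h : SmoothMetric n N) (u v : Param → M → N) : Prop :=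
  ∀ K : Set M, IsCompact K → ∀ δ : ℝ≥0∞, 0 < δ → ∃ ε₀ : ℝ, 0 < ε₀ ∧
    ∀ ε : Param, (ε : ℝ) < ε₀ → ∀ x ∈ K, riemDist h (u ε x) (v ε x) < δ

section Manifolds

variable {m n : ℕ} {M N : Type*}
  [TopologicalSpace M] [ChartedSpace (EuclideanSpace ℝ (Fin m)) M]
  [TopologicalSpace N] [ChartedSpace (EuclideanSpace ℝ (Fin n)) N]

/-- Moderateness in charts: for every `k`, all charts `(V, φ)` of `M` and `(W, ψ)` of `N`, and all
compact `L ⊆ V`, `L' ⊆ W` there is `p ∈ ℕ` such that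
`sup_{x ∈ L ∩ u_ε⁻¹(L')} ‖D^k(ψ ∘ u_ε ∘ φ⁻¹)(φ(x))‖ = O(ε^{-p})` as `ε → 0`. -/
def IsModerate (m n : ℕ) {M N : Type*}
    [TopologicalSpace M] [ChartedSpace (EuclideanSpace ℝ (Fin m)) M]
    [TopologicalSpace N] [ChartedSpace (EuclideanSpace ℝ (Fin n)) N]
    (u : Param → M → N) : Prop :=
  ∀ k : ℕ, ∀ φ ∈ IsManifold.maximalAtlas (𝓡 m) ∞ M, ∀ ψ ∈ IsManifold.maximalAtlas (𝓡 n) ∞ N,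
    ∀ L : Set M, IsCompact L → L ⊆ φ.source → ∀ L' : Set N, IsCompact L' → L' ⊆ ψ.source →
      ∃ p : ℕ, ∃ C : ℝ, ∃ ε₀ : ℝ, 0 < ε₀ ∧ ∀ ε : Param, (ε : ℝ) < ε₀ →
        ∀ x ∈ L, u ε x ∈ L' →
          ‖iteratedFDeriv ℝ k (fun y => ψ (u ε (φ.symm y))) (φ x)‖ ≤ C * ((ε : ℝ) ^ p)⁻¹

/-- Negligibility of the difference in charts: for all `k, q ∈ ℕ`, all charts `(V, φ)` of `M` and
`(W, ψ)` of `N`, and all compact `L ⊆ V`, `L' ⊆ W`,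
`sup_{x ∈ L ∩ u_ε⁻¹(L') ∩ v_ε⁻¹(L')} ‖D^k(ψ ∘ u_ε ∘ φ⁻¹ - ψ ∘ v_ε ∘ φ⁻¹)(φ(x))‖ = O(ε^q)`. -/
def IsNegligibleDiff (m n : ℕ) {M N : Type*}
    [TopologicalSpace M] [ChartedSpace (EuclideanSpace ℝ (Fin m)) M]
    [TopologicalSpace N] [ChartedSpace (EuclideanSpace ℝ (Fin n)) N]
    (u v : Param → M → N) : Prop :=
  ∀ k q : ℕ, ∀ φ ∈ IsManifold.maximalAtlas (𝓡 m) ∞ M, ∀ ψ ∈ IsManifold.maximalAtlas (𝓡 n) ∞ N,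
    ∀ L : Set M, IsCompact L → L ⊆ φ.source → ∀ L' : Set N, IsCompact L' → L' ⊆ ψ.source →
      ∃ C : ℝ, ∃ ε₀ : ℝ, 0 < ε₀ ∧ ∀ ε : Param, (ε : ℝ) < ε₀ →
        ∀ x ∈ L, u ε x ∈ L' → v ε x ∈ L' →
          ‖iteratedFDeriv ℝ k (fun y => ψ (u ε (φ.symm y)) - ψ (v ε (φ.symm y))) (φ x)‖
            ≤ C * (ε : ℝ) ^ q

/-- The set `E_M[M,N]` of c-bounded moderate nets of smooth maps `M → N` (no condition on the
dependence on `ε`). -/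
def moderateNets (m n : ℕ) (M N : Type*)
    [TopologicalSpace M] [ChartedSpace (EuclideanSpace ℝ (Fin m)) M]
    [TopologicalSpace N] [ChartedSpace (EuclideanSpace ℝ (Fin n)) N] : Set (Param → M → N) :=
  {u | (∀ ε, ContMDiff (𝓡 m) (𝓡 n) ∞ (u ε)) ∧ IsCBounded u ∧ IsModerate m n u}

/-- `E_{M,co}[M,N]`: the nets in `E_M[M,N]` for which `(ε, x) ↦ u_ε(x)` is continuous in `ε`
(and smooth in `x`). -/
def moderateNetsCo (m n : ℕ) (M N : Type*)
    [TopologicalSpace M] [ChartedSpace (EuclideanSpace ℝ (Fin m)) M]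
    [TopologicalSpace N] [ChartedSpace (EuclideanSpace ℝ (Fin n)) N] : Set (Param → M → N) :=
  {u | u ∈ moderateNets m n M N ∧ ∀ x : M, Continuous fun ε : Param => u ε x}

/-- `E_{M,sm}[M,N]`: the nets in `E_M[M,N]` for which `(ε, x) ↦ u_ε(x)` is smooth on
`(0,1] × M`. -/
def moderateNetsSm (m n : ℕ) (M N : Type*)
    [TopologicalSpace M] [ChartedSpace (EuclideanSpace ℝ (Fin m)) M]
    [TopologicalSpace N] [ChartedSpace (EuclideanSpace ℝ (Fin n)) N] : Set (Param → M → N) :=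
  {u | u ∈ moderateNets m n M N ∧
    ContMDiffOn (𝓘(ℝ, ℝ).prod (𝓡 m)) (𝓡 n) ∞
      (fun z : ℝ × M => u (toParam z.1) z.2) (Set.Ioc (0 : ℝ) 1 ×ˢ Set.univ)}

theorem moderateNetsSm_subset : moderateNetsSm m n M N ⊆ moderateNetsCo m n M N := by
  rintro u ⟨hu, hs⟩
  refine ⟨hu, fun x => ?_⟩
  have h1 : Continuous fun ε : Param => ((ε : ℝ), x) := by fun_prop
  have h2 := hs.continuousOn.comp_continuous h1 (fun ε => ⟨ε.2, mem_univ _⟩)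
  convert h2 using 2 with ε
  have : toParam (ε : ℝ) = ε := by simp [toParam]
  simp only [Function.comp_apply, this]

variable [IsManifold (𝓡 n) ∞ N]

/-- Equivalence of nets: uniform closeness on compact sets with respect to some Riemannian metric
on `N`, and negligibility of the difference in charts. -/
def NetEquiv (m n : ℕ) {M N : Type*}
    [TopologicalSpace M] [ChartedSpace (EuclideanSpace ℝ (Fin m)) M]
    [TopologicalSpace N] [ChartedSpace (EuclideanSpace ℝ (Fin n)) N] [IsManifold (𝓡 n) ∞ N]
    (u v : Param → M → N) : Prop :=
  (∃ h : SmoothMetric n N, UnifClose h u v) ∧ IsNegligibleDiff m n u v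

theorem unifClose_iff [T2Space N] (h : SmoothMetric n N) {u v : Param → M → N}
    (hu : IsCBounded u) (hv : IsCBounded v) :
    UnifClose h u v ↔ ∀ O : Set (N × N), IsOpen O → (∀ p, (p, p) ∈ O) → ∀ K : Set M,
      IsCompact K → ∃ ε₀ : ℝ, 0 < ε₀ ∧ ∀ ε : Param, (ε : ℝ) < ε₀ → ∀ x ∈ K,
        (u ε x, v ε x) ∈ O := by
  obtain ⟨hc, h0, hsep, -⟩ := riemDist_spec h
  constructor
  · intro H O hO hdiag K hK
    obtain ⟨ε₁, h₁, K₁, hK₁, hu₁⟩ := hu K hK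
    obtain ⟨ε₂, h₂, K₂, hK₂, hv₂⟩ := hv K hK
    obtain ⟨δ, hδ, hδO⟩ : ∃ δ : ℝ≥0∞, 0 < δ ∧ ∀ p ∈ K₁, ∀ q ∈ K₂, riemDist h p q < δ →
        (p, q) ∈ O := by
      have hcomp : IsCompact ((K₁ ×ˢ K₂) \ O) := (hK₁.prod hK₂).diff hO
      rcases ((K₁ ×ˢ K₂) \ O).eq_empty_or_nonempty with he | hne
      · refine ⟨1, one_pos, fun p hp q hq _ => ?_⟩
        by_contra hn
        have : (p, q) ∈ (K₁ ×ˢ K₂) \ O := ⟨⟨hp, hq⟩, hn⟩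
        simp [he] at this
      · obtain ⟨z, hz, hmin⟩ := hcomp.exists_isMinOn hne hc.continuousOn
        refine ⟨riemDist h z.1 z.2, ?_, fun p hp q hq hlt => ?_⟩
        · rw [pos_iff_ne_zero]
          intro hz0
          apply hz.2
          have := hsep _ _ hz0
          have hz' : z = (z.1, z.1) := Prod.ext rfl this.symm
          rw [hz']
          exact hdiag _
        · by_contra hn
          exact absurd hlt (not_lt.2 (hmin (show (p, q) ∈ (K₁ ×ˢ K₂) \ O from ⟨⟨hp, hq⟩, hn⟩)))
    obtain ⟨ε₃, h₃, H₃⟩ := H K hK δ hδ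
    refine ⟨min ε₁ (min ε₂ ε₃), by positivity, fun ε hε x hx => ?_⟩
    simp only [lt_min_iff] at hε
    exact hδO _ (hu₁ ε hε.1 x hx) _ (hv₂ ε hε.2.1 x hx) (H₃ ε hε.2.2 x hx)
  · intro H K hK δ hδ
    exact H {z | riemDist h z.1 z.2 < δ} (isOpen_lt hc continuous_const)
      (fun p => by simpa [h0] using hδ) K hK

theorem contDiffAt_chart {f : M → N} (hf : ContMDiff (𝓡 m) (𝓡 n) ∞ f)
    {φ : OpenPartialHomeomorph M (EuclideanSpace ℝ (Fin m))}
    (hφ : φ ∈ IsManifold.maximalAtlas (𝓡 m) ∞ M)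
    {ψ : OpenPartialHomeomorph N (EuclideanSpace ℝ (Fin n))}
    (hψ : ψ ∈ IsManifold.maximalAtlas (𝓡 n) ∞ N) {x : M} (hx : x ∈ φ.source)
    (hfx : f x ∈ ψ.source) (k : ℕ) :
    ContDiffAt ℝ k (fun y => ψ (f (φ.symm y))) (φ x) := by
  have h1 : ContMDiffAt (𝓡 m) (𝓡 m) ∞ φ.symm (φ x) :=
    contMDiffAt_symm_of_mem_maximalAtlas hφ (φ.map_source hx)
  have h2 : ContMDiffAt (𝓡 m) (𝓡 n) ∞ f (φ.symm (φ x)) := hf _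
  have h3 : ContMDiffAt (𝓡 n) (𝓡 n) ∞ ψ (f (φ.symm (φ x))) := by
    rw [φ.left_inv hx]
    exact contMDiffAt_of_mem_maximalAtlas hψ hfx
  have h4 : ContMDiffAt (𝓡 m) (𝓡 n) ∞ (fun y => ψ (f (φ.symm y))) (φ x) :=
    h3.comp (φ x) (h2.comp (φ x) h1)
  exact (contMDiffAt_iff_contDiffAt.1 h4).of_le (by exact_mod_cast le_top)

theorem netEquiv_refl [T2Space N] [SecondCountableTopology N] (u : Param → M → N) :
    NetEquiv m n u u := by
  refine ⟨?_, ?_⟩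
  · obtain ⟨h⟩ := nonempty_smoothMetric n N
    refine ⟨h, fun K _ δ hδ => ⟨1, one_pos, fun ε _ x _ => ?_⟩⟩
    rwa [(riemDist_spec h).2.1]
  · intro k q φ _ ψ _ L _ _ L' _ _
    refine ⟨0, 1, one_pos, fun ε _ x _ _ _ => ?_⟩
    simp

theorem netEquiv_symm [T2Space N] {u v : Param → M → N} (H : NetEquiv m n u v) :
    NetEquiv m n v u := by
  obtain ⟨⟨h, hc⟩, hd⟩ := H
  refine ⟨⟨h, fun K hK δ hδ => ?_⟩, ?_⟩
  · obtain ⟨ε₀, h₀, H₀⟩ := hc K hK δ hδ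
    refine ⟨ε₀, h₀, fun ε hε x hx => ?_⟩
    rw [(riemDist_spec h).2.2.2]
    exact H₀ ε hε x hx
  · intro k q φ hφ ψ hψ L hL hLφ L' hL' hLψ
    obtain ⟨C, ε₀, h₀, H₀⟩ := hd k q φ hφ ψ hψ L hL hLφ L' hL' hLψ
    refine ⟨C, ε₀, h₀, fun ε hε x hx hv hu => ?_⟩
    have h1 := H₀ ε hε x hx hu hv
    have h2 : (fun y => ψ (v ε (φ.symm y)) - ψ (u ε (φ.symm y)))
        = -(fun y => ψ (u ε (φ.symm y)) - ψ (v ε (φ.symm y))) := by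
      funext y
      simp
    rw [h2, iteratedFDeriv_neg_apply, norm_neg]
    exact h1

theorem netEquiv_trans [T2Space N] {u v w : Param → M → N}
    (hu : u ∈ moderateNets m n M N) (hv : v ∈ moderateNets m n M N)
    (hw : w ∈ moderateNets m n M N) (H : NetEquiv m n u v) (H' : NetEquiv m n v w) :
    NetEquiv m n u w := by
  have := Manifold.locallyCompact_of_finiteDimensional (M := N) (𝓡 n)
  obtain ⟨⟨h, hc⟩, hd⟩ := H
  obtain ⟨⟨h', hc'⟩, hd'⟩ := H'
  rw [unifClose_iff h hu.2.1 hv.2.1] at hc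
  rw [unifClose_iff h' hv.2.1 hw.2.1] at hc'
  refine ⟨⟨h, ?_⟩, ?_⟩
  · have hc'' := (unifClose_iff h hv.2.1 hw.2.1).2 hc'
    have hcu := (unifClose_iff h hu.2.1 hv.2.1).2 hc
    intro K hK δ hδ
    obtain ⟨ε₁, h₁, H₁⟩ := hcu K hK (δ / 2) (ENNReal.half_pos hδ.ne')
    obtain ⟨ε₂, h₂, H₂⟩ := hc'' K hK (δ / 2) (ENNReal.half_pos hδ.ne')
    refine ⟨min ε₁ ε₂, by positivity, fun ε hε x hx => ?_⟩
    simp only [lt_min_iff] at hε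
    have htri : riemDist h (u ε x) (w ε x)
        ≤ riemDist h (u ε x) (v ε x) + riemDist h (v ε x) (w ε x) := riemDist_triangle h _ _ _
    calc _ ≤ _ := htri
      _ < δ / 2 + δ / 2 := ENNReal.add_lt_add (H₁ ε hε.1 x hx) (H₂ ε hε.2 x hx)
      _ = δ := ENNReal.add_halves δ
  · intro k q φ hφ ψ hψ L hL hLφ L' hL' hLψ
    obtain ⟨L'', hL'', hLL, hLψ'⟩ := exists_compact_between hL' ψ.open_source hLψ
    have hsub : L' ⊆ L'' := hLL.trans interior_subset
    obtain ⟨C₁, ε₁, h₁, H₁⟩ := hd k q φ hφ ψ hψ L hL hLφ L'' hL'' hLψ'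
    obtain ⟨C₂, ε₂, h₂, H₂⟩ := hd' k q φ hφ ψ hψ L hL hLφ L'' hL'' hLψ'
    have hO : IsOpen ((L'ᶜ ×ˢ (univ : Set N)) ∪ ((univ : Set N) ×ˢ interior L'')) :=
      (hL'.isClosed.isOpen_compl.prod isOpen_univ).union (isOpen_univ.prod isOpen_interior)
    obtain ⟨ε₃, h₃, H₃⟩ := hc _ hO (fun p => by
      by_cases hp : p ∈ L'
      · exact Or.inr ⟨mem_univ _, hLL hp⟩
      · exact Or.inl ⟨hp, mem_univ _⟩) L hL
    refine ⟨C₁ + C₂, min ε₁ (min ε₂ ε₃), by positivity, fun ε hε x hx hux hwx => ?_⟩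
    simp only [lt_min_iff] at hε
    have hvx : v ε x ∈ L'' := by
      rcases H₃ ε hε.2.2 x hx with h | h
      · exact absurd hux h.1
      · exact interior_subset h.2
    have e1 := H₁ ε hε.1 x hx (hsub hux) hvx
    have e2 := H₂ ε hε.2.1 x hx hvx (hsub hwx)
    have cu := contDiffAt_chart (hu.1 ε) hφ hψ (hLφ hx) (hLψ hux) k
    have cv := contDiffAt_chart (hv.1 ε) hφ hψ (hLφ hx) (hLψ' hvx) k
    have cw := contDiffAt_chart (hw.1 ε) hφ hψ (hLφ hx) (hLψ hwx) k
    have hsum : (fun y => ψ (u ε (φ.symm y)) - ψ (w ε (φ.symm y)))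
        = (fun y => ψ (u ε (φ.symm y)) - ψ (v ε (φ.symm y)))
          + (fun y => ψ (v ε (φ.symm y)) - ψ (w ε (φ.symm y))) := by
      funext y
      simp
    rw [hsum, iteratedFDeriv_add_apply (cu.sub cv) (cv.sub cw), add_mul]
    exact (norm_add_le _ _).trans (add_le_add e1 e2)

end Manifolds

/-- Equivalence of nets, as an equivalence relation on any set of c-bounded moderate nets. -/
def netSetoid (m n : ℕ) (M N : Type*)
    [TopologicalSpace M] [ChartedSpace (EuclideanSpace ℝ (Fin m)) M] [IsManifold (𝓡 m) ∞ M]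
    [TopologicalSpace N] [ChartedSpace (EuclideanSpace ℝ (Fin n)) N] [IsManifold (𝓡 n) ∞ N]
    [T2Space N] [SecondCountableTopology N]
    (S : Set (Param → M → N)) (hS : S ⊆ moderateNets m n M N) : Setoid S where
  r u v := NetEquiv m n u.1 v.1
  iseqv :=
    { refl := fun u => netEquiv_refl u.1
      symm := fun h => netEquiv_symm h
      trans := fun {u v w} h h' => netEquiv_trans (hS u.2) (hS v.2) (hS w.2) h h' }

/-- `G_co[M,N]`. -/
def GCo (m n : ℕ) (M N : Type*)
    [TopologicalSpace M] [ChartedSpace (EuclideanSpace ℝ (Fin m)) M] [IsManifold (𝓡 m) ∞ M]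
    [TopologicalSpace N] [ChartedSpace (EuclideanSpace ℝ (Fin n)) N] [IsManifold (𝓡 n) ∞ N]
    [T2Space N] [SecondCountableTopology N] : Type _ :=
  Quotient (netSetoid m n M N (moderateNetsCo m n M N) fun _ hu => hu.1)

/-- `G_sm[M,N]`. -/
def GSm (m n : ℕ) (M N : Type*)
    [TopologicalSpace M] [ChartedSpace (EuclideanSpace ℝ (Fin m)) M] [IsManifold (𝓡 m) ∞ M]
    [TopologicalSpace N] [ChartedSpace (EuclideanSpace ℝ (Fin n)) N] [IsManifold (𝓡 n) ∞ N]
    [T2Space N] [SecondCountableTopology N] : Type _ :=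
  Quotient (netSetoid m n M N (moderateNetsSm m n M N) fun _ hu => hu.1)

/-- The natural map `τ_sm : G_sm[M,N] → G_co[M,N]`, `[(u_ε)_ε] ↦ [(u_ε)_ε]`. -/
def tauSm (m n : ℕ) (M N : Type*)
    [TopologicalSpace M] [ChartedSpace (EuclideanSpace ℝ (Fin m)) M] [IsManifold (𝓡 m) ∞ M]
    [TopologicalSpace N] [ChartedSpace (EuclideanSpace ℝ (Fin n)) N] [IsManifold (𝓡 n) ∞ N]
    [T2Space N] [SecondCountableTopology N] : GSm m n M N → GCo m n M N :=
  Quotient.map' (s₁ := netSetoid m n M N (moderateNetsSm m n M N) fun _ hu => hu.1)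
    (s₂ := netSetoid m n M N (moderateNetsCo m n M N) fun _ hu => hu.1)
    (fun u => ⟨u.1, moderateNetsSm_subset u.2⟩) (fun _ _ h => h)

end Nets

end GenFun

/-! Injectivity is immediate, because both quotients are formed with the same relation. For
surjectivity, a net `u` that is only continuous in `ε` has to be replaced by an equivalent one that
is smooth in `(ε, x)`.

Write `s = 1/ε`. Moderateness of first derivatives gives Lipschitz bounds in `x` that are locally
uniform in `ε`, so continuity in `ε` for fixed `x` improves to joint continuity, locally in `x` and
for small `ε` (`exists_nhds_eventually_continuousAt`). A smooth proper function `S` marks the region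
`S(x) ≤ s` where this is available (`exists_smooth_threshold`). Compactness of `{S ≤ r}` then
permits nodes `a 0 < a 1 < …` tending to infinity, so dense that over `{S ≤ a k}` the maps `u_{1/s}`
with `a k ≤ s ≤ a (k + 1)` are as close to each other as desired (`IsInterpolation.exists_step`).
Successive nodes are joined by a smooth interpolation `c(t, p, q)` of nearby points, built from
moves in charts (`exists_isInterpolation`). Replacing `s` by a smooth function that always exceeds
`S(x) + 1`, and equals `s` once `s ≥ S(x) + 3`, makes the net smooth on all of `(0,1] × M` and
changes nothing over a compact set for small `ε` (`IsInterpolation.exists_smooth_net`).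

The nodes around `s` are comparable to `s`, so the chain rule keeps the new net moderate
(`IsInterpolation.isModerate`). Closeness is prescribed to be `exp (-j)` with `j ≥ 1/ε - 1`, which
beats every power of `ε`. This controls values only; derivatives follow from Landau's inequality,
which trades the decay of a lower derivative against a moderate bound on a higher one
(`isNegligibleDiff_of_order_zero`). -/

namespace GenFun

open Set Filter Bundle

/-! ### Derivative estimates in normed spaces and in a chart of the target. -/

section Calculus

variable {E F G : Type*} [NormedAddCommGroup E] [NormedSpace ℝ E]
  [NormedAddCommGroup F] [NormedSpace ℝ F] [NormedAddCommGroup G] [NormedSpace ℝ G]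

/-- Landau's inequality: a bound on `g` and on the oscillation of its derivative over a ball bounds
the derivative at the centre. -/
theorem norm_fderiv_le_of_oscillation {g : E → F} {y₀ : E} {h A B : ℝ} (hh : 0 < h)
    (hd : ∀ y ∈ Metric.closedBall y₀ h, DifferentiableAt ℝ g y)
    (hA : ∀ y ∈ Metric.closedBall y₀ h, ‖g y‖ ≤ A)
    (hB : ∀ y ∈ Metric.closedBall y₀ h, ‖fderiv ℝ g y - fderiv ℝ g y₀‖ ≤ B) :
    ‖fderiv ℝ g y₀‖ ≤ 2 * A / h + B := by
  have h0 : y₀ ∈ Metric.closedBall y₀ h := Metric.mem_closedBall_self hh.le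
  have hA0 : 0 ≤ A := (norm_nonneg _).trans (hA y₀ h0)
  have hB0 : 0 ≤ B := (norm_nonneg _).trans (hB y₀ h0)
  refine ContinuousLinearMap.opNorm_le_of_unit_norm (by positivity) fun w hw => ?_
  have h1 : y₀ + h • w ∈ Metric.closedBall y₀ h := by
    simp [norm_smul, hw, abs_of_pos hh]
  -- Step of length `h` in the unit direction `w`: the increment of `g` is at most `2A`, and it
  -- differs from `h • Dg(y₀) w` by at most `B h`.
  have h2 := Convex.norm_image_sub_le_of_norm_fderiv_le' hd hB (convex_closedBall y₀ h) h0 h1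
  have h3 : ‖y₀ + h • w - y₀‖ = h := by simp [norm_smul, hw, abs_of_pos hh]
  rw [h3, add_sub_cancel_left, map_smul] at h2
  have h4 : ‖h • fderiv ℝ g y₀ w‖ ≤ 2 * A + B * h := by
    calc ‖h • fderiv ℝ g y₀ w‖
        = ‖g (y₀ + h • w) - g y₀ - (g (y₀ + h • w) - g y₀ - h • fderiv ℝ g y₀ w)‖ := by
          congr 1; abel
      _ ≤ ‖g (y₀ + h • w)‖ + ‖g y₀‖ + ‖g (y₀ + h • w) - g y₀ - h • fderiv ℝ g y₀ w‖ :=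
          (norm_sub_le _ _).trans (by gcongr; exact norm_sub_le _ _)
      _ ≤ A + A + B * h := by gcongr; exacts [hA _ h1, hA _ h0]
      _ = 2 * A + B * h := by ring
  rw [norm_smul, Real.norm_eq_abs, abs_of_pos hh] at h4
  calc ‖fderiv ℝ g y₀ w‖ ≤ (2 * A + B * h) / h := by rw [le_div_iff₀ hh]; linarith
    _ = 2 * A / h + B := by field_simp

/-- Local version of `norm_iteratedFDeriv_comp_le`. -/
theorem norm_iteratedFDeriv_comp_le_of_contDiffOn {g : F → G} {f : E → F} {k : ℕ} {t : Set F}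
    {x : E} (ht : IsOpen t) (hg : ContDiffOn ℝ k g t) (hf : ContDiffAt ℝ k f x) (hx : f x ∈ t)
    {C D : ℝ} (hC : ∀ i ≤ k, ‖iteratedFDeriv ℝ i g (f x)‖ ≤ C)
    (hD : ∀ i, 1 ≤ i → i ≤ k → ‖iteratedFDeriv ℝ i f x‖ ≤ D ^ i) :
    ‖iteratedFDeriv ℝ k (g ∘ f) x‖ ≤ k.factorial * C * D ^ k := by
  have h1 : ∀ᶠ y in 𝓝 x, ContDiffAt ℝ k f y := hf.eventually (by simp)
  have h2 : ∀ᶠ y in 𝓝 x, f y ∈ t := hf.continuousAt (ht.mem_nhds hx)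
  obtain ⟨s, hs, hso, hxs⟩ := eventually_nhds_iff.1 (h1.and h2)
  have hfs : ContDiffOn ℝ k f s := fun y hy => (hs y hy).1.contDiffWithinAt
  have := norm_iteratedFDerivWithin_comp_le hg hfs le_rfl ht.uniqueDiffOn hso.uniqueDiffOn
    (fun y hy => (hs y hy).2) hxs (C := C) (D := D)
    (fun i hi => by rw [iteratedFDerivWithin_of_isOpen i ht hx]; exact hC i hi)
    (fun i h1 hi => by rw [iteratedFDerivWithin_of_isOpen i hso hxs]; exact hD i h1 hi)
  rwa [iteratedFDerivWithin_of_isOpen k hso hxs] at this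

/-- The derivatives of a function which is smooth near a compact set are bounded near it. -/
theorem exists_isOpen_norm_iteratedFDeriv_le {g : E → F} {K : Set E} (hK : IsCompact K)
    (hg : ∀ z ∈ K, ∀ᶠ z' in 𝓝 z, ContDiffAt ℝ ∞ g z') (k : ℕ) :
    ∃ C : ℝ, 0 ≤ C ∧ ∃ t : Set E, IsOpen t ∧ K ⊆ t ∧ (∀ z ∈ t, ContDiffAt ℝ ∞ g z) ∧
      ∀ z ∈ t, ∀ i ≤ k, ‖iteratedFDeriv ℝ i g z‖ ≤ C := by
  have hloc : ∀ z ∈ K, ∃ C : ℝ, 0 ≤ C ∧ ∀ᶠ z' in 𝓝 z, ContDiffAt ℝ ∞ g z' ∧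
      ∀ i ≤ k, ‖iteratedFDeriv ℝ i g z'‖ ≤ C := by
    intro z hz
    have hi : ∀ i : ℕ, ∀ᶠ z' in 𝓝 z,
        ‖iteratedFDeriv ℝ i g z'‖ ≤ ‖iteratedFDeriv ℝ i g z‖ + 1 := by
      intro i
      have hc : ContinuousAt (iteratedFDeriv ℝ i g) z :=
        (hg z hz).self_of_nhds.continuousAt_iteratedFDeriv (k := i) (by exact_mod_cast le_top)
      filter_upwards [hc.norm.eventually_lt_const (lt_add_one _)] with z' hz'
      exact hz'.le
    -- A sum of nonnegative bounds serves as a common bound; the same device is used below for the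
    -- finite subcover.
    refine ⟨∑ i ∈ Finset.range (k + 1), (‖iteratedFDeriv ℝ i g z‖ + 1), by positivity, ?_⟩
    have := (Finset.eventually_all (Finset.range (k + 1))).2 fun i _ => hi i
    filter_upwards [this, hg z hz] with z' h1 h2
    refine ⟨h2, fun i hik => (h1 i (by simpa using Nat.lt_succ_of_le hik)).trans ?_⟩
    exact Finset.single_le_sum (f := fun i => ‖iteratedFDeriv ℝ i g z‖ + 1)
      (fun _ _ => by positivity) (by simpa using Nat.lt_succ_of_le hik)
  choose! C hC0 hC using hloc
  have hC' : ∀ z ∈ K, ∃ t, IsOpen t ∧ z ∈ t ∧ ∀ z' ∈ t, ContDiffAt ℝ ∞ g z' ∧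
      ∀ i ≤ k, ‖iteratedFDeriv ℝ i g z'‖ ≤ C z := by
    intro z hz
    obtain ⟨t, h1, h2, h3⟩ := eventually_nhds_iff.1 (hC z hz)
    exact ⟨t, h2, h3, h1⟩
  choose! t hto hzt ht using hC'
  obtain ⟨b, hb⟩ := hK.elim_nhds_subcover' (fun z hz => t z)
    (fun z hz => (hto z hz).mem_nhds (hzt z hz))
  refine ⟨∑ z ∈ b, C z, Finset.sum_nonneg fun z _ => hC0 z z.2, ⋃ z ∈ b, t z,
    isOpen_biUnion fun z _ => hto z z.2, hb, ?_, ?_⟩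
  · intro z hz
    simp only [mem_iUnion] at hz
    obtain ⟨w, hw, hz⟩ := hz
    exact (ht w w.2 z hz).1
  · intro z hz i hi
    simp only [mem_iUnion] at hz
    obtain ⟨w, hw, hz⟩ := hz
    exact ((ht w w.2 z hz).2 i hi).trans (Finset.single_le_sum (f := fun z : K => C z)
      (fun z _ => hC0 z z.2) hw)

/-- Mean value inequality in a chart `ψ` for a map `g` whose derivative is only controlled where `g`
takes values in a set `L'`: on a short segment `g` does not leave `L'`. -/
theorem norm_chart_sub_le_of_segment {N : Type*} [TopologicalSpace N] [T2Space N]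
    [ProperSpace F] (ψ : OpenPartialHomeomorph N F) {L' : Set N} {g : E → N} {y₁ y₂ : E}
    {r Λ : ℝ} (hg : ∀ t ∈ Icc (0 : ℝ) 1, ContinuousAt g (y₁ + t • (y₂ - y₁)))
    (hsrc : g y₁ ∈ ψ.source)
    (hball : ∀ z ∈ Metric.closedBall (ψ (g y₁)) r, z ∈ ψ.target ∧ ψ.symm z ∈ L')
    (hd : ∀ t ∈ Icc (0 : ℝ) 1, g (y₁ + t • (y₂ - y₁)) ∈ L' →
      DifferentiableAt ℝ (fun y => ψ (g y)) (y₁ + t • (y₂ - y₁)) ∧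
        ‖fderiv ℝ (fun y => ψ (g y)) (y₁ + t • (y₂ - y₁))‖ ≤ Λ)
    (hr : Λ * ‖y₂ - y₁‖ < r) (hΛ : 0 ≤ Λ) :
    g y₂ ∈ L' ∧ ‖ψ (g y₂) - ψ (g y₁)‖ ≤ Λ * ‖y₂ - y₁‖ := by
  set γ : ℝ → E := fun t => y₁ + t • (y₂ - y₁) with hγ
  have hγc : Continuous γ := by fun_prop
  -- A closed ball pulled back by the chart is compact, hence closed in `N`, and lies in `L'`. This
  -- makes the set of good times `s` closed, although `L'` itself is not assumed closed.
  set L'' : Set N := ψ.symm '' Metric.closedBall (ψ (g y₁)) r with hL''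
  have hL''c : IsClosed L'' := ((isCompact_closedBall _ _).image_of_continuousOn
    (ψ.continuousOn_symm.mono fun z hz => (hball z hz).1)).isClosed
  have hL''s : L'' ⊆ ψ.source := by
    rintro _ ⟨z, hz, rfl⟩
    exact ψ.map_target (hball z hz).1
  have hL''L : L'' ⊆ L' := by
    rintro _ ⟨z, hz, rfl⟩
    exact (hball z hz).2
  have hmem : ∀ p ∈ ψ.source, ‖ψ p - ψ (g y₁)‖ ≤ r → p ∈ L'' := fun p hp hpr =>
    ⟨ψ p, by rwa [Metric.mem_closedBall, dist_eq_norm], ψ.left_inv hp⟩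
  set ℓ := ‖y₂ - y₁‖ with hℓ
  have hℓ0 : 0 ≤ ℓ := norm_nonneg _
  have hr0 : 0 < r := (by positivity : 0 ≤ Λ * ℓ).trans_lt hr
  set s : Set ℝ := {t | g (γ t) ∈ L'' ∧ ‖ψ (g (γ t)) - ψ (g y₁)‖ ≤ Λ * ℓ * t} with hs
  have hgc : ContinuousOn (fun t => g (γ t)) (Icc 0 1) := fun t ht =>
    (ContinuousAt.comp (f := γ) (hg t ht) hγc.continuousAt).continuousWithinAt
  have hc1 : IsClosed (Icc (0 : ℝ) 1 ∩ (fun t => g (γ t)) ⁻¹' L'') :=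
    hgc.preimage_isClosed_of_isClosed isClosed_Icc hL''c
  have hc2 : IsClosed (s ∩ Icc (0 : ℝ) 1) := by
    have : ContinuousOn (fun t => ‖ψ (g (γ t)) - ψ (g y₁)‖)
        (Icc (0 : ℝ) 1 ∩ (fun t => g (γ t)) ⁻¹' L'') := by
      refine ContinuousOn.norm (ContinuousOn.sub ?_ continuousOn_const)
      exact ψ.continuousOn.comp (hgc.mono inter_subset_left) fun t ht => hL''s ht.2
    have h := hc1.isClosed_le this (g := fun t => Λ * ℓ * t) (by fun_prop)
    convert h using 1
    ext t
    simp only [hs, mem_inter_iff, mem_ofPred_eq, mem_preimage]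
    tauto
  -- Continuous induction along the segment: `s` is closed, contains `0`, and can be prolonged from
  -- each of its points before `1`.
  have hsub : Icc (0 : ℝ) 1 ⊆ s := by
    refine hc2.Icc_subset_of_forall_exists_gt ?_ ?_
    · refine ⟨hmem _ (by simpa [hγ] using hsrc) (by simpa [hγ] using hr0.le), by simp [hγ]⟩
    · rintro t ⟨⟨ht1, ht2⟩, ht0, ht3⟩ y hy
      have htI : t ∈ Icc (0 : ℝ) 1 := ⟨ht0, ht3.le⟩
      -- Since `Λ ℓ < r` strictly, the curve is in the open ball at time `t` and cannot leave `L''`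
      -- at once; on the short interval gained, the derivative bound is in force.
      have hlt : ‖ψ (g (γ t)) - ψ (g y₁)‖ < r := by
        refine ht2.trans_lt (lt_of_le_of_lt ?_ hr)
        have : 0 ≤ Λ * ℓ := by positivity
        nlinarith
      have hev : ∀ᶠ τ in 𝓝 t, g (γ τ) ∈ L'' := by
        have hga : ContinuousAt (fun τ => g (γ τ)) t :=
          ContinuousAt.comp (f := γ) (hg t htI) hγc.continuousAt
        have h1 : ∀ᶠ τ in 𝓝 t, g (γ τ) ∈ ψ.source :=
          hga (ψ.open_source.mem_nhds (hL''s ht1))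
        have h2 : ContinuousAt (fun τ => ‖ψ (g (γ τ)) - ψ (g y₁)‖) t :=
          ((ContinuousAt.comp (f := fun τ => g (γ τ)) (ψ.continuousAt (hL''s ht1)) hga).sub
            continuousAt_const).norm
        filter_upwards [h1, h2.eventually_lt_const hlt] with τ h1 h2
        exact hmem _ h1 h2.le
      obtain ⟨η, hη, hηL⟩ := Metric.eventually_nhds_iff.1 hev
      obtain ⟨b, hb1, hb2⟩ : ∃ b, t < b ∧ b < min (min y 1) (t + η) :=
        exists_between (by simp only [lt_min_iff]; exact ⟨⟨hy, ht3⟩, by linarith⟩)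
      simp only [lt_min_iff] at hb2
      have hL : ∀ τ ∈ Icc t b, g (γ τ) ∈ L'' := fun τ hτ => hηL (by
        rw [Real.dist_eq, abs_of_nonneg (by linarith [hτ.1])]
        linarith [hτ.2])
      have hmv := norm_image_sub_le_of_norm_deriv_le_segment' (a := t) (b := b)
        (f := fun τ => ψ (g (γ τ))) (f' := fun τ => fderiv ℝ (fun y => ψ (g y)) (γ τ) (y₂ - y₁))
        (C := Λ * ℓ) (fun τ hτ => by
          have hτI : τ ∈ Icc (0 : ℝ) 1 := ⟨ht0.trans hτ.1, hτ.2.trans hb2.1.2.le⟩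
          have hγd : HasDerivAt γ (y₂ - y₁) τ := by
            simpa [hγ] using ((hasDerivAt_id τ).smul_const (y₂ - y₁)).const_add y₁
          exact ((hd τ hτI (hL''L (hL τ hτ))).1.hasFDerivAt.comp_hasDerivAt τ
            hγd).hasDerivWithinAt)
        (fun τ hτ => by
          have hτI : τ ∈ Icc (0 : ℝ) 1 := ⟨ht0.trans hτ.1, hτ.2.le.trans hb2.1.2.le⟩
          exact (ContinuousLinearMap.le_opNorm _ _).trans (by
            gcongr; exact (hd τ hτI (hL''L (hL τ ⟨hτ.1, hτ.2.le⟩))).2))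
        b ⟨hb1.le, le_rfl⟩
      refine ⟨b, ⟨hL b ⟨hb1.le, le_rfl⟩, ?_⟩, hb1, hb2.1.1.le⟩
      calc ‖ψ (g (γ b)) - ψ (g y₁)‖
          ≤ ‖ψ (g (γ b)) - ψ (g (γ t))‖ + ‖ψ (g (γ t)) - ψ (g y₁)‖ := norm_sub_le_norm_sub_add_norm_sub _ _ _
        _ ≤ Λ * ℓ * (b - t) + Λ * ℓ * t := add_le_add hmv ht2
        _ = Λ * ℓ * b := by ring
  obtain ⟨h1, h2⟩ := hsub (right_mem_Icc.2 zero_le_one)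
  have hγ1 : γ 1 = y₂ := by simp [hγ]
  rw [hγ1] at h1 h2
  exact ⟨hL''L h1, by simpa using h2⟩

end Calculus

/-! ### The filter `ε → 0` and powers of `ε`. -/

section SmallParameters

/-- The filter of parameters `ε → 0`. -/
def smallParam : Filter Param := comap (fun ε : Param => (ε : ℝ)) (𝓝 0)

theorem eventually_smallParam {P : Param → Prop} :
    (∀ᶠ ε in smallParam, P ε) ↔ ∃ ε₀ : ℝ, 0 < ε₀ ∧ ∀ ε : Param, (ε : ℝ) < ε₀ → P ε := by
  rw [smallParam, (Metric.nhds_basis_ball.comap _).eventually_iff]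
  refine exists_congr fun r => and_congr_right fun _ => forall_congr' fun ε => ?_
  simp [abs_of_pos ε.2.1]

theorem tendsto_smallParam : Tendsto (fun ε : Param => (ε : ℝ)) smallParam (𝓝 0) :=
  tendsto_comap

theorem eventually_mul_pow_lt (C : ℝ) {δ : ℝ} (hδ : 0 < δ) {k : ℕ} (hk : k ≠ 0) :
    ∀ᶠ ε : Param in smallParam, C * (ε : ℝ) ^ k < δ := by
  have h : Tendsto (fun ε : Param => C * (ε : ℝ) ^ k) smallParam (𝓝 (C * 0 ^ k)) :=
    (tendsto_smallParam.pow k).const_mul C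
  rw [zero_pow hk, mul_zero] at h
  exact h.eventually_lt_const hδ

/-- As `ε ≤ 1`, enlarging the constant and the exponent only weakens a moderate bound. Finitely many
such bounds can thus be merged by adding constants and exponents. -/
theorem mul_inv_pow_le {C C' : ℝ} {p p' : ℕ} (hC : C ≤ C') (hC' : 0 ≤ C') (hp : p ≤ p') (ε : Param) :
    C * ((ε : ℝ) ^ p)⁻¹ ≤ C' * ((ε : ℝ) ^ p')⁻¹ := by
  have h0 : 0 < (ε : ℝ) := ε.2.1
  gcongr ?_ * ?_
  exact inv_anti₀ (by positivity) (pow_le_pow_of_le_one h0.le ε.2.2 hp)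

end SmallParameters

/-- A compact subset of a chart domain has a compact neighbourhood containing balls of a uniform
radius in the chart. -/
theorem exists_compact_uniform_ball {X F : Type*} [TopologicalSpace X] [NormedAddCommGroup F]
    [ProperSpace F] (φ : OpenPartialHomeomorph X F) {L : Set X} (hL : IsCompact L)
    (hLφ : L ⊆ φ.source) :
    ∃ r : ℝ, 0 < r ∧ ∃ L₂ : Set X, IsCompact L₂ ∧ L ⊆ L₂ ∧ L₂ ⊆ φ.source ∧
      ∀ x ∈ L, ∀ y ∈ Metric.closedBall (φ x) r, y ∈ φ.target ∧ φ.symm y ∈ L₂ := by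
  have hc : IsCompact (φ '' L) := hL.image_of_continuousOn (φ.continuousOn.mono hLφ)
  obtain ⟨r, hr, hrt⟩ := hc.exists_cthickening_subset_open φ.open_target (by
    rintro _ ⟨x, hx, rfl⟩
    exact φ.map_source (hLφ hx))
  refine ⟨r, hr, φ.symm '' Metric.cthickening r (φ '' L),
    hc.cthickening.image_of_continuousOn (φ.continuousOn_symm.mono hrt), ?_, ?_, ?_⟩
  · exact fun x hx => ⟨φ x, Metric.self_subset_cthickening _ ⟨x, hx, rfl⟩, φ.left_inv (hLφ hx)⟩
  · rintro _ ⟨z, hz, rfl⟩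
    exact φ.map_target (hrt hz)
  · intro x hx y hy
    have := Metric.closedBall_subset_cthickening (mem_image_of_mem φ hx) r hy
    exact ⟨hrt this, y, this, rfl⟩

/-! ### Lipschitz bounds for moderate nets, and negligibility from order zero. -/

section Moderate

variable {m n : ℕ} {M N : Type*}
  [TopologicalSpace M] [ChartedSpace (EuclideanSpace ℝ (Fin m)) M]
  [TopologicalSpace N] [ChartedSpace (EuclideanSpace ℝ (Fin n)) N]

theorem IsModerate.eventually_le {u : Param → M → N} (hu : IsModerate m n u) (k : ℕ)
    {φ : OpenPartialHomeomorph M (EuclideanSpace ℝ (Fin m))}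
    (hφ : φ ∈ IsManifold.maximalAtlas (𝓡 m) ∞ M)
    {ψ : OpenPartialHomeomorph N (EuclideanSpace ℝ (Fin n))}
    (hψ : ψ ∈ IsManifold.maximalAtlas (𝓡 n) ∞ N) {L : Set M} (hL : IsCompact L)
    (hLφ : L ⊆ φ.source) {L' : Set N} (hL' : IsCompact L') (hLψ : L' ⊆ ψ.source) :
    ∃ p : ℕ, ∃ C : ℝ, 0 ≤ C ∧ ∀ᶠ ε in smallParam, ∀ x ∈ L, u ε x ∈ L' →
      ‖iteratedFDeriv ℝ k (fun y => ψ (u ε (φ.symm y))) (φ x)‖ ≤ C * ((ε : ℝ) ^ p)⁻¹ := by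
  obtain ⟨p, C, h⟩ := hu k φ hφ ψ hψ L hL hLφ L' hL' hLψ
  refine ⟨p, |C|, abs_nonneg C, ?_⟩
  filter_upwards [eventually_smallParam.2 h] with ε h x hx hx'
  exact (h x hx hx').trans (mul_inv_pow_le (le_abs_self C) (abs_nonneg C) le_rfl ε)

variable [IsManifold (𝓡 n) ∞ N] [T2Space N]

/-- Moderate nets are Lipschitz on compact sets in charts, with moderate constants. -/
theorem IsModerate.eventually_norm_sub_le {u : Param → M → N} (hu : IsModerate m n u)
    (hs : ∀ ε, ContMDiff (𝓡 m) (𝓡 n) ∞ (u ε))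
    {φ : OpenPartialHomeomorph M (EuclideanSpace ℝ (Fin m))}
    (hφ : φ ∈ IsManifold.maximalAtlas (𝓡 m) ∞ M)
    {ψ : OpenPartialHomeomorph N (EuclideanSpace ℝ (Fin n))}
    (hψ : ψ ∈ IsManifold.maximalAtlas (𝓡 n) ∞ N) {L : Set M} (hL : IsCompact L)
    (hLφ : L ⊆ φ.source) {L' : Set N} (hL' : IsCompact L') (hLψ : L' ⊆ ψ.source) :
    ∃ p : ℕ, ∃ C : ℝ, 0 ≤ C ∧ ∀ᶠ ε in smallParam, ∀ x ∈ L, u ε x ∈ ψ.source → ∀ y r,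
      (∀ z ∈ segment ℝ (φ x) y, z ∈ φ.target ∧ φ.symm z ∈ L) →
      (∀ z ∈ Metric.closedBall (ψ (u ε x)) r, z ∈ ψ.target ∧ ψ.symm z ∈ L') →
      ∀ Λ, C * ((ε : ℝ) ^ p)⁻¹ ≤ Λ → Λ * ‖y - φ x‖ < r →
        u ε (φ.symm y) ∈ L' ∧ ‖ψ (u ε (φ.symm y)) - ψ (u ε x)‖ ≤ Λ * ‖y - φ x‖ := by
  -- Only first derivatives enter. The majorant `Λ` is left free so that one Lipschitz constant can
  -- serve several nets or a whole range of `ε`.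
  obtain ⟨p, C, hC, h⟩ := hu.eventually_le 1 hφ hψ hL hLφ hL' hLψ
  refine ⟨p, C, hC, ?_⟩
  filter_upwards [h] with ε h x hx hux y r hseg hball Λ hCΛ hΛ
  have hε : 0 < (ε : ℝ) := ε.2.1
  have hmem : ∀ t ∈ Icc (0 : ℝ) 1, φ x + t • (y - φ x) ∈ segment ℝ (φ x) y := by
    intro t ht
    rw [segment_eq_image']
    exact ⟨t, ht, rfl⟩
  have hx0 : φ.symm (φ x) = x := φ.left_inv (hLφ hx)
  have key := norm_chart_sub_le_of_segment ψ (L' := L') (g := fun z => u ε (φ.symm z))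
    (y₁ := φ x) (y₂ := y) (r := r) (Λ := Λ) (fun t ht => by
      have h1 := hseg _ (hmem t ht)
      exact ContinuousAt.comp (f := φ.symm) (hs ε).continuous.continuousAt
        (φ.continuousAt_symm h1.1))
    (by simpa only [hx0] using hux) (by simpa only [hx0] using hball) (fun t ht hL => by
      obtain ⟨h1, h2⟩ := hseg _ (hmem t ht)
      have h3 := h _ h2 hL
      have h4 := contDiffAt_chart (hs ε) hφ hψ (hLφ h2) (hLψ hL) 1
      rw [φ.right_inv h1] at h3 h4
      rw [norm_iteratedFDeriv_one] at h3
      exact ⟨h4.differentiableAt (by simp), h3.trans hCΛ⟩) hΛ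
    (le_trans (by positivity) hCΛ)
  simpa only [hx0] using key

/-- For moderate nets, negligibility of the difference of order zero implies negligibility of all
derivatives. -/
theorem isNegligibleDiff_of_order_zero {u v : Param → M → N}
    (hu : IsModerate m n u) (hus : ∀ ε, ContMDiff (𝓡 m) (𝓡 n) ∞ (u ε))
    (hv : IsModerate m n v) (hvs : ∀ ε, ContMDiff (𝓡 m) (𝓡 n) ∞ (v ε))
    (h0 : ∀ q : ℕ, ∀ ψ ∈ IsManifold.maximalAtlas (𝓡 n) ∞ N, ∀ L : Set M, IsCompact L →
      ∀ L' : Set N, IsCompact L' → L' ⊆ ψ.source → ∃ C : ℝ, ∀ᶠ ε in smallParam,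
        ∀ x ∈ L, u ε x ∈ L' → v ε x ∈ L' → ‖ψ (u ε x) - ψ (v ε x)‖ ≤ C * (ε : ℝ) ^ q) :
    IsNegligibleDiff m n u v := by
  intro k
  induction k with
  | zero =>
    intro q φ hφ ψ hψ L hL hLφ L' hL' hLψ
    obtain ⟨C, hC⟩ := h0 q ψ hψ L hL L' hL' hLψ
    refine ⟨C, eventually_smallParam.1 ?_⟩
    filter_upwards [hC] with ε hC x hx h1 h2
    rw [norm_iteratedFDeriv_zero, φ.left_inv (hLφ hx)]
    exact hC x hx h1 h2
  | succ k ih =>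
    intro q φ hφ ψ hψ L hL hLφ L' hL' hLψ
    obtain ⟨r₀, hr₀, L₂, hL₂, hLL₂, hL₂φ, hball⟩ := exists_compact_uniform_ball φ hL hLφ
    obtain ⟨r₁, hr₁, L₂', hL₂', hLL₂', hL₂ψ, hball'⟩ := exists_compact_uniform_ball ψ hL' hLψ
    obtain ⟨p₁, C₁, hC₁, H₁⟩ := hu.eventually_norm_sub_le hus hφ hψ hL₂ hL₂φ hL₂' hL₂ψ
    obtain ⟨p₂, C₂, hC₂, H₂⟩ := hv.eventually_norm_sub_le hvs hφ hψ hL₂ hL₂φ hL₂' hL₂ψ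
    obtain ⟨p₃, C₃, hC₃, H₃⟩ := hu.eventually_le (k + 2) hφ hψ hL₂ hL₂φ hL₂' hL₂ψ
    obtain ⟨p₄, C₄, hC₄, H₄⟩ := hv.eventually_le (k + 2) hφ hψ hL₂ hL₂φ hL₂' hL₂ψ
    -- Landau's inequality will be applied with step `h = ε^Q`. With `Λ = C ε^{-P}`, the choice `Q =
    -- P + q + 1` gives `Λ h = C ε^{q+1}`, and the induction hypothesis at order `Q + q` still
    -- leaves `ε^q` after division by `h`.
    set P := p₁ + p₂ + p₃ + p₄ with hP
    set C := C₁ + C₂ + C₃ + C₄ with hC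
    set Q := P + q + 1 with hQ
    obtain ⟨C₅, hC₅⟩ := ih (Q + q) φ hφ ψ hψ L₂ hL₂ hL₂φ L₂' hL₂' hL₂ψ
    refine ⟨2 * C₅ + 2 * C, eventually_smallParam.1 ?_⟩
    filter_upwards [H₁, H₂, H₃, H₄, eventually_smallParam.2 hC₅,
      eventually_mul_pow_lt 1 hr₀ (k := Q) (by omega),
      eventually_mul_pow_lt C hr₁ (k := q + 1) (by omega)] with ε H₁ H₂ H₃ H₄ H₅ hr₀' hr₁' x hx hux hvx
    have hε : 0 < (ε : ℝ) := ε.2.1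
    have hε1 : (ε : ℝ) ≤ 1 := ε.2.2
    rw [one_mul] at hr₀'
    set h := (ε : ℝ) ^ Q with hh
    have hh0 : 0 < h := by positivity
    have hPh : ((ε : ℝ) ^ P)⁻¹ * h = (ε : ℝ) ^ (q + 1) := by
      rw [hh, hQ, add_assoc, pow_add _ P, inv_mul_cancel_left₀ (by positivity)]
    set Λ := C * ((ε : ℝ) ^ P)⁻¹ with hΛ
    have hΛ0 : 0 ≤ Λ := by positivity
    have hΛh : Λ * h = C * (ε : ℝ) ^ (q + 1) := by rw [hΛ, mul_assoc, hPh]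
    -- Moderate bounds hold only where the nets take values in a compact subset of the chart. The
    -- Lipschitz estimate keeps both nets inside `L₂'` over the whole ball, as `Λ h < r₁`.
    have hin : ∀ y ∈ Metric.closedBall (φ x) h, y ∈ φ.target ∧ φ.symm y ∈ L₂ ∧
        u ε (φ.symm y) ∈ L₂' ∧ v ε (φ.symm y) ∈ L₂' := by
      intro y hy
      have hb : Metric.closedBall (φ x) h ⊆ Metric.closedBall (φ x) r₀ :=
        Metric.closedBall_subset_closedBall hr₀'.le
      obtain ⟨h1, h2⟩ := hball x hx y (hb hy)
      have hseg : ∀ z ∈ segment ℝ (φ x) y, z ∈ φ.target ∧ φ.symm z ∈ L₂ := fun z hz =>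
        hball x hx z (hb ((convex_closedBall _ _).segment_subset
          (Metric.mem_closedBall_self hh0.le) hy hz))
      have hlt : Λ * ‖y - φ x‖ < r₁ := by
        rw [Metric.mem_closedBall, dist_eq_norm] at hy
        exact (mul_le_mul_of_nonneg_left hy hΛ0).trans_lt (by rwa [hΛh])
      exact ⟨h1, h2,
        (H₁ x (hLL₂ hx) (hLψ hux) y r₁ hseg (hball' _ hux) Λ
          (mul_inv_pow_le (by linarith) (by linarith) (by omega) ε) hlt).1,
        (H₂ x (hLL₂ hx) (hLψ hvx) y r₁ hseg (hball' _ hvx) Λ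
          (mul_inv_pow_le (by linarith) (by linarith) (by omega) ε) hlt).1⟩
    set f : EuclideanSpace ℝ (Fin m) → EuclideanSpace ℝ (Fin n) :=
      fun y => ψ (u ε (φ.symm y)) - ψ (v ε (φ.symm y)) with hf
    have hfu : ∀ y ∈ Metric.closedBall (φ x) h, ∀ j : ℕ,
        ContDiffAt ℝ j (fun y => ψ (u ε (φ.symm y))) y := by
      intro y hy j
      obtain ⟨h1, h2, h3, h4⟩ := hin y hy
      have := contDiffAt_chart (hus ε) hφ hψ (hL₂φ h2) (hL₂ψ h3) j
      rwa [φ.right_inv h1] at this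
    have hfv : ∀ y ∈ Metric.closedBall (φ x) h, ∀ j : ℕ,
        ContDiffAt ℝ j (fun y => ψ (v ε (φ.symm y))) y := by
      intro y hy j
      obtain ⟨h1, h2, h3, h4⟩ := hin y hy
      have := contDiffAt_chart (hvs ε) hφ hψ (hL₂φ h2) (hL₂ψ h4) j
      rwa [φ.right_inv h1] at this
    have hfc : ∀ y ∈ Metric.closedBall (φ x) h, ∀ j : ℕ, ContDiffAt ℝ j f y :=
      fun y hy j => (hfu y hy j).sub (hfv y hy j)
    -- The moderate bound of order `k + 2` limits the oscillation of the derivative of order `k + 1`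
    -- over the ball to `2 Λ h`.
    have hD2 : ∀ y ∈ Metric.closedBall (φ x) h, ‖fderiv ℝ (iteratedFDeriv ℝ (k + 1) f) y‖ ≤ 2 * Λ := by
      intro y hy
      obtain ⟨h1, h2, h3, h4⟩ := hin y hy
      have e3 := H₃ _ h2 h3
      have e4 := H₄ _ h2 h4
      rw [φ.right_inv h1] at e3 e4
      rw [norm_fderiv_iteratedFDeriv]
      have hsub : f = (fun y => ψ (u ε (φ.symm y))) - (fun y => ψ (v ε (φ.symm y))) := rfl
      rw [hsub, iteratedFDeriv_sub_apply (hfu y hy _) (hfv y hy _), two_mul]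
      refine (norm_sub_le _ _).trans ?_
      exact add_le_add (e3.trans (mul_inv_pow_le (by linarith) (by linarith) (by omega) ε))
        (e4.trans (mul_inv_pow_le (by linarith) (by linarith) (by omega) ε))
    have hx0 : φ x ∈ Metric.closedBall (φ x) h := Metric.mem_closedBall_self hh0.le
    have key := norm_fderiv_le_of_oscillation (g := iteratedFDeriv ℝ k f) (y₀ := φ x) hh0
      (A := C₅ * (ε : ℝ) ^ (Q + q)) (B := 2 * (C * (ε : ℝ) ^ (q + 1)))
      (fun y hy => (hfc y hy (k + 1)).differentiableAt_iteratedFDeriv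
        (by exact_mod_cast Nat.lt_succ_self k))
      (fun y hy => by
        obtain ⟨h1, h2, h3, h4⟩ := hin y hy
        have := H₅ _ h2 h3 h4
        rwa [φ.right_inv h1] at this)
      (fun y hy => by
        rw [fderiv_iteratedFDeriv, Function.comp_apply, Function.comp_apply, ← map_sub,
          LinearIsometryEquiv.norm_map]
        refine (Convex.norm_image_sub_le_of_norm_fderiv_le (fun z hz =>
          (hfc z hz (k + 2)).differentiableAt_iteratedFDeriv
            (by exact_mod_cast Nat.lt_succ_self (k + 1))) hD2 (convex_closedBall _ _) hx0 hy).trans ?_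
        rw [Metric.mem_closedBall, dist_eq_norm] at hy
        calc 2 * Λ * ‖y - φ x‖ ≤ 2 * Λ * h := by gcongr
          _ = 2 * (C * (ε : ℝ) ^ (q + 1)) := by rw [mul_assoc, hΛh])
    rw [norm_fderiv_iteratedFDeriv] at key
    refine key.trans ?_
    have e1 : 2 * (C₅ * (ε : ℝ) ^ (Q + q)) / h = 2 * C₅ * (ε : ℝ) ^ q := by
      rw [pow_add, ← hh]
      field_simp
    have e2 : (ε : ℝ) ^ (q + 1) ≤ (ε : ℝ) ^ q :=
      pow_le_pow_of_le_one hε.le hε1 (Nat.le_succ q)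
    rw [e1]
    calc 2 * C₅ * (ε : ℝ) ^ q + 2 * (C * (ε : ℝ) ^ (q + 1))
        ≤ 2 * C₅ * (ε : ℝ) ^ q + 2 * (C * (ε : ℝ) ^ q) := by gcongr
      _ = _ := by ring

end Moderate

/-! ### Joint continuity and reparametrization of nets. -/

section ModerateNets

variable {m n : ℕ} {M N : Type*}
  [TopologicalSpace M] [ChartedSpace (EuclideanSpace ℝ (Fin m)) M]
  [TopologicalSpace N] [ChartedSpace (EuclideanSpace ℝ (Fin n)) N]

/-- A c-bounded moderate net that is continuous in `ε` is, locally in `x` and for small `ε`, jointly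
continuous. -/
theorem exists_nhds_eventually_continuousAt [IsManifold (𝓡 m) ∞ M] [IsManifold (𝓡 n) ∞ N]
    [T2Space N] {u : Param → M → N} (hu : u ∈ moderateNetsCo m n M N) (x₀ : M) :
    ∃ V ∈ 𝓝 x₀, ∀ᶠ ε in smallParam, ∀ x ∈ V,
      ContinuousAt (fun z : Param × M => u z.1 z.2) (ε, x) := by
  have := Manifold.locallyCompact_of_finiteDimensional (M := M) (𝓡 m)
  have := Manifold.locallyCompact_of_finiteDimensional (M := N) (𝓡 n)
  obtain ⟨⟨hs, hb, hm⟩, hc⟩ := hu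
  set φ := chartAt (EuclideanSpace ℝ (Fin m)) x₀
  have hφ : φ ∈ IsManifold.maximalAtlas (𝓡 m) ∞ M := IsManifold.chart_mem_maximalAtlas x₀
  obtain ⟨L, hL, hx₀L, hLφ⟩ := exists_compact_subset φ.open_source
    (mem_chart_source (EuclideanSpace ℝ (Fin m)) x₀)
  obtain ⟨ε₁, hε₁, K', hK', huK⟩ := hb L hL
  have hψ : ∀ p : N, chartAt (EuclideanSpace ℝ (Fin n)) p ∈ IsManifold.maximalAtlas (𝓡 n) ∞ N :=
    fun p => IsManifold.chart_mem_maximalAtlas p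
  choose L' hL' hpL' hLψ using fun p : N => exists_compact_subset
    (chartAt (EuclideanSpace ℝ (Fin n)) p).open_source (mem_chart_source (EuclideanSpace ℝ (Fin n)) p)
  -- Finitely many chart pieces cover `K'`, so one threshold `ε₀` works for every value `u ε x` with
  -- `x ∈ L`.
  obtain ⟨b, hb⟩ := hK'.elim_finite_subcover (fun p => interior (L' p)) (fun p => isOpen_interior)
    (fun p _ => mem_iUnion.2 ⟨p, hpL' p⟩)
  choose P C hC H using fun p : N => hm.eventually_norm_sub_le hs hφ (hψ p) hL hLφ (hL' p) (hLψ p)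
  obtain ⟨ε₀, hε₀, H₀⟩ := eventually_smallParam.1
    (((Finset.eventually_all b).2 fun p _ => H p).and (eventually_smallParam.2 ⟨ε₁, hε₁, huK⟩))
  refine ⟨interior L, isOpen_interior.mem_nhds hx₀L, eventually_smallParam.2 ⟨ε₀, hε₀, ?_⟩⟩
  intro ε hε x hx
  have hxL : x ∈ L := interior_subset hx
  have hεpos : 0 < (ε : ℝ) := ε.2.1
  obtain ⟨p, hpb, hp⟩ : ∃ p ∈ b, u ε x ∈ interior (L' p) := by
    simpa using hb ((H₀ ε hε).2 x hxL)
  set ψ := chartAt (EuclideanSpace ℝ (Fin n)) p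
  have hsrc : u ε x ∈ ψ.source := hLψ p (interior_subset hp)
  -- Radius `2r` leaves room for recentring: balls of radius `r` about `ψ (u ε' x)` still fit when
  -- `ε'` is near `ε`.
  obtain ⟨r, hr, hball⟩ : ∃ r > 0, Metric.closedBall (ψ (u ε x)) (2 * r) ⊆
      ψ.target ∩ ψ.symm ⁻¹' interior (L' p) := by
    have : ψ.target ∩ ψ.symm ⁻¹' interior (L' p) ∈ 𝓝 (ψ (u ε x)) :=
      (ψ.symm.isOpen_inter_preimage isOpen_interior).mem_nhds
        ⟨ψ.map_source hsrc, by rwa [mem_preimage, ψ.left_inv hsrc]⟩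
    obtain ⟨r, hr, h⟩ := Metric.nhds_basis_closedBall.mem_iff.1 this
    exact ⟨r / 2, half_pos hr, by rwa [mul_div_cancel₀ _ two_ne_zero]⟩
  obtain ⟨ρ, hρ, hballφ⟩ : ∃ ρ > 0, Metric.ball (φ x) ρ ⊆ φ.target ∩ φ.symm ⁻¹' interior L := by
    have : φ.target ∩ φ.symm ⁻¹' interior L ∈ 𝓝 (φ x) :=
      (φ.symm.isOpen_inter_preimage isOpen_interior).mem_nhds
        ⟨φ.map_source (hLφ hxL), by rwa [mem_preimage, φ.left_inv (hLφ hxL)]⟩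
    exact Metric.nhds_basis_ball.mem_iff.1 this
  -- A Lipschitz constant valid for all parameters above `ε / 2`, hence near `ε`.
  set Λ := C p * (((ε : ℝ) / 2) ^ P p)⁻¹ with hΛ
  have hΛ0 : 0 ≤ Λ := mul_nonneg (hC p) (by positivity)
  have hcε : ContinuousAt (fun z : Param × M => u z.1 x) (ε, x) :=
    ((hc x).comp continuous_fst).continuousAt
  have hcψ : ContinuousAt (fun z : Param × M => ψ (u z.1 x)) (ε, x) :=
    ContinuousAt.comp (f := fun z : Param × M => u z.1 x) (ψ.continuousAt hsrc) hcε
  have hcφ : ContinuousAt (fun z : Param × M => φ z.2) (ε, x) :=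
    ContinuousAt.comp (f := fun z : Param × M => z.2) (φ.continuousAt (hLφ hxL)) continuousAt_snd
  have t1 : Tendsto (fun z : Param × M => ‖ψ (u z.1 x) - ψ (u ε x)‖) (𝓝 (ε, x)) (𝓝 0) := by
    exact tendsto_iff_norm_sub_tendsto_zero.1 hcψ
  have t2 : Tendsto (fun z : Param × M => ‖φ z.2 - φ x‖) (𝓝 (ε, x)) (𝓝 0) := by
    exact tendsto_iff_norm_sub_tendsto_zero.1 hcφ
  have t3 : Tendsto (fun z : Param × M => Λ * ‖φ z.2 - φ x‖) (𝓝 (ε, x)) (𝓝 0) := by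
    simpa using t2.const_mul Λ
  have hcv : ContinuousAt (fun z : Param × M => (z.1 : ℝ)) (ε, x) := by fun_prop
  -- Compare through `u z.1 x`: the change in `x` is Lipschitz with the uniform constant `Λ`, and
  -- the change in the parameter at fixed `x` is small by hypothesis.
  have key : ∀ᶠ z : Param × M in 𝓝 (ε, x), u z.1 z.2 ∈ ψ.source ∧
      ‖ψ (u z.1 z.2) - ψ (u ε x)‖ ≤ Λ * ‖φ z.2 - φ x‖ + ‖ψ (u z.1 x) - ψ (u ε x)‖ := by
    filter_upwards [hcε (ψ.open_source.mem_nhds hsrc), t1.eventually_lt_const hr,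
      t2.eventually_lt_const hρ, t3.eventually_lt_const hr, hcv.eventually_lt_const hε,
      hcv.eventually_const_lt (half_lt_self hεpos),
      continuousAt_snd (φ.open_source.mem_nhds (hLφ hxL))] with z h1 h2 h3 h4 h5 h6 h7
    have hz0 : 0 < (z.1 : ℝ) := z.1.2.1
    have := (H₀ z.1 h5).1 p hpb x hxL h1 (φ z.2) r
      (fun w hw => by
        have hw' := hballφ ((convex_ball (φ x) ρ).segment_subset (Metric.mem_ball_self hρ)
          (by rwa [Metric.mem_ball, dist_eq_norm]) hw)
        exact ⟨hw'.1, interior_subset hw'.2⟩)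
      (fun w hw => by
        have hw' := hball (show w ∈ Metric.closedBall (ψ (u ε x)) (2 * r) from by
          rw [Metric.mem_closedBall] at hw ⊢
          calc dist w (ψ (u ε x)) ≤ dist w (ψ (u z.1 x)) + dist (ψ (u z.1 x)) (ψ (u ε x)) :=
                dist_triangle _ _ _
            _ ≤ r + r := by
                rw [dist_eq_norm (ψ (u z.1 x))]
                exact add_le_add hw h2.le
            _ = 2 * r := by ring)
        exact ⟨hw'.1, interior_subset hw'.2⟩)
      Λ (by
        rw [hΛ]
        gcongr
        exact hC p) h4
    rw [φ.left_inv h7] at this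
    refine ⟨hLψ p this.1, ?_⟩
    calc ‖ψ (u z.1 z.2) - ψ (u ε x)‖ ≤ ‖ψ (u z.1 z.2) - ψ (u z.1 x)‖ + ‖ψ (u z.1 x) - ψ (u ε x)‖ :=
          norm_sub_le_norm_sub_add_norm_sub _ _ _
      _ ≤ _ := by gcongr; exact this.2
  have t4 : Tendsto (fun z : Param × M => ψ (u z.1 z.2)) (𝓝 (ε, x)) (𝓝 (ψ (u ε x))) := by
    rw [tendsto_iff_norm_sub_tendsto_zero]
    refine squeeze_zero' (Eventually.of_forall fun _ => norm_nonneg _)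
      (key.mono fun z hz => hz.2) ?_
    simpa using t3.add t1
  have t5 := (ψ.continuousAt_symm (ψ.map_source hsrc)).tendsto.comp t4
  rw [ψ.left_inv hsrc] at t5
  refine t5.congr' (key.mono fun z hz => ?_)
  exact ψ.left_inv hz.1

/-- Reparametrizing by `a(ε)` comparable to `ε` preserves c-bounded moderate nets. -/
theorem comp_mem_moderateNets {u : Param → M → N} (hu : u ∈ moderateNets m n M N)
    {a : Param → Param} (ha : ∀ ε, (a ε : ℝ) ≤ 2 * ε) (ha' : ∀ ε : Param, (ε : ℝ) ≤ 2 * a ε) :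
    (fun ε => u (a ε)) ∈ moderateNets m n M N := by
  obtain ⟨hs, hb, hm⟩ := hu
  refine ⟨fun ε => hs _, fun K hK => ?_, fun k φ hφ ψ hψ L hL hLφ L' hL' hLψ => ?_⟩
  · obtain ⟨ε₀, h₀, K', hK', H⟩ := hb K hK
    exact ⟨ε₀ / 2, half_pos h₀, K', hK', fun ε hε x hx => H _ (by linarith [ha ε]) x hx⟩
  · obtain ⟨p, C, ε₀, h₀, H⟩ := hm k φ hφ ψ hψ L hL hLφ L' hL' hLψ
    -- The bound `ε ≤ 2 a(ε)` costs the factor `2 ^ p`; `a(ε) ≤ 2ε` halves the threshold.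
    refine ⟨p, |C| * 2 ^ p, ε₀ / 2, half_pos h₀, fun ε hε x hx hux => ?_⟩
    refine (H _ (by linarith [ha ε]) x hx hux).trans ?_
    have h1 : 0 < (a ε : ℝ) := (a ε).2.1
    have h2 : 0 < (ε : ℝ) := ε.2.1
    rw [mul_assoc]
    gcongr ?_ * ?_
    · exact le_abs_self C
    · rw [← div_eq_mul_inv, le_div_iff₀ (by positivity), inv_mul_le_iff₀ (by positivity), ← mul_pow,
        mul_comm]
      exact pow_le_pow_left₀ h2.le (ha' ε) p

end ModerateNets

/-! ### Smooth interpolation between nearby points of a manifold. -/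

section Interpolation

variable {n : ℕ} {N : Type*} [TopologicalSpace N] [ChartedSpace (EuclideanSpace ℝ (Fin n)) N]

/-- A countable locally finite family of smooth bump functions supported in charts, such that every
point has a neighbourhood on which one of them is `1`. -/
theorem exists_bump_sequence [IsManifold (𝓡 n) ∞ N] [T2Space N] [SigmaCompactSpace N] [Nonempty N] :
    ∃ (e : ℕ → OpenPartialHomeomorph N (EuclideanSpace ℝ (Fin n))) (η : ℕ → N → ℝ),
      (∀ i, e i ∈ IsManifold.maximalAtlas (𝓡 n) ∞ N) ∧
      (∀ i, ContMDiff (𝓡 n) 𝓘(ℝ) ∞ (η i)) ∧ (∀ i, tsupport (η i) ⊆ (e i).source) ∧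
      (LocallyFinite fun i => tsupport (η i)) ∧ ∀ p, ∃ i, η i =ᶠ[𝓝 p] 1 := by
  obtain ⟨ι, fs, hfs⟩ := SmoothBumpCovering.exists_isSubordinate (𝓡 n) (isClosed_univ (X := N))
    (U := fun x => (chartAt (EuclideanSpace ℝ (Fin n)) x).source)
    (fun x _ => chart_source_mem_nhds _ x)
  have hlf : LocallyFinite fun i => tsupport (fs i) := fs.locallyFinite.closure
  have hcount : Countable ι := countable_univ_iff.1
    (fs.locallyFinite.countable_univ fun i => (fs i).nonempty_support)
  obtain ⟨f, hf⟩ := exists_injective_nat ι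
  obtain ⟨p₀⟩ := ‹Nonempty N›
  -- Indices outside the range of `f` receive the zero function and an arbitrary chart, for which
  -- every requirement is trivial.
  set η : ℕ → N → ℝ := Function.extend f (fun i => (fs i : N → ℝ)) 0
  set e : ℕ → OpenPartialHomeomorph N (EuclideanSpace ℝ (Fin n)) :=
    Function.extend f (fun i => chartAt (EuclideanSpace ℝ (Fin n)) (fs.c i))
      (fun _ => chartAt (EuclideanSpace ℝ (Fin n)) p₀)
  have hη : ∀ i, η (f i) = fs i := fun i => hf.extend_apply _ _ i
  have he : ∀ i, e (f i) = chartAt (EuclideanSpace ℝ (Fin n)) (fs.c i) :=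
    fun i => hf.extend_apply _ _ i
  have hη' : ∀ j, (¬∃ i, f i = j) → η j = 0 := fun j hj => Function.extend_apply' _ _ j hj
  have he' : ∀ j, (¬∃ i, f i = j) → e j = chartAt (EuclideanSpace ℝ (Fin n)) p₀ :=
    fun j hj => Function.extend_apply' _ _ j hj
  refine ⟨e, η, fun j => ?_, fun j => ?_, fun j => ?_, fun p => ?_, fun p => ?_⟩
  · by_cases hj : ∃ i, f i = j
    · obtain ⟨i, rfl⟩ := hj
      rw [he]
      exact IsManifold.chart_mem_maximalAtlas _
    · rw [he' j hj]
      exact IsManifold.chart_mem_maximalAtlas _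
  · by_cases hj : ∃ i, f i = j
    · obtain ⟨i, rfl⟩ := hj
      rw [hη]
      exact (fs i).contMDiff
    · rw [hη' j hj]
      exact contMDiff_const
  · by_cases hj : ∃ i, f i = j
    · obtain ⟨i, rfl⟩ := hj
      rw [hη, he]
      exact hfs i
    · rw [hη' j hj]
      simp [tsupport]
  · obtain ⟨V, hV, hfin⟩ := hlf p
    refine ⟨V, hV, (hfin.image f).subset fun j hj => ?_⟩
    by_cases h : ∃ i, f i = j
    · obtain ⟨i, rfl⟩ := h
      change (tsupport (η (f i)) ∩ V).Nonempty at hj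
      rw [hη] at hj
      exact ⟨i, hj, rfl⟩
    · change (tsupport (η j) ∩ V).Nonempty at hj
      rw [hη' j h] at hj
      simp [tsupport] at hj
  · refine ⟨f (fs.ind p (mem_univ p)), ?_⟩
    rw [hη]
    exact fs.eventuallyEq_one p (mem_univ p)

open Classical in
/-- Move the point `p` towards `q` inside the chart `e`, by the fraction `t η(p)` of the way. -/
noncomputable def chartMove (e : OpenPartialHomeomorph N (EuclideanSpace ℝ (Fin n))) (η : N → ℝ)
    (z : ℝ × N × N) : N :=
  if z.2.1 ∈ e.source ∧ z.2.2 ∈ e.source then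
    e.symm (e z.2.1 + (z.1 * η z.2.1) • (e z.2.2 - e z.2.1)) else z.2.1

section chartMove

variable {e : OpenPartialHomeomorph N (EuclideanSpace ℝ (Fin n))} {η : N → ℝ}

theorem chartMove_self (t : ℝ) (p : N) : chartMove e η (t, p, p) = p := by
  by_cases hp : p ∈ e.source <;> simp [chartMove, hp]

theorem chartMove_zero (p q : N) : chartMove e η (0, p, q) = p := by
  by_cases hp : p ∈ e.source <;> simp [chartMove, hp]

theorem chartMove_of_eq_zero (t : ℝ) {p : N} (q : N) (h : η p = 0) :
    chartMove e η (t, p, q) = p := by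
  by_cases hp : p ∈ e.source <;> simp [chartMove, hp, h]

theorem chartMove_one {p q : N} (h : η p = 1) (hp : p ∈ e.source) (hq : q ∈ e.source) :
    chartMove e η (1, p, q) = q := by
  simp [chartMove, hp, hq, h]

/-- On the diagonal the displacement vanishes, so for every `t` the chart formula stays in
`e.target` nearby and is smooth there. If `p` lies outside the chart, it lies outside the support of
`η`, and the move is locally the first projection. -/
theorem eventually_contMDiffAt_chartMove [IsManifold (𝓡 n) ∞ N]
    (he : e ∈ IsManifold.maximalAtlas (𝓡 n) ∞ N) (hη : ContMDiff (𝓡 n) 𝓘(ℝ) ∞ η)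
    (hs : tsupport η ⊆ e.source) (t : ℝ) (p : N) :
    ∀ᶠ z in 𝓝 (t, p, p),
      ContMDiffAt (𝓘(ℝ).prod ((𝓡 n).prod (𝓡 n))) (𝓡 n) ∞ (chartMove e η) z := by
  have c1 : Continuous fun z : ℝ × N × N => z.2.1 := by fun_prop
  have c2 : Continuous fun z : ℝ × N × N => z.2.2 := by fun_prop
  by_cases hp : p ∈ e.source
  · set g : ℝ × N × N → EuclideanSpace ℝ (Fin n) :=
      fun z => e z.2.1 + (z.1 * η z.2.1) • (e z.2.2 - e z.2.1) with hg
    have hev : ∀ᶠ z : ℝ × N × N in 𝓝 (t, p, p), z.2.1 ∈ e.source ∧ z.2.2 ∈ e.source :=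
      (c1.continuousAt.eventually_mem (e.open_source.mem_nhds hp)).and
        (c2.continuousAt.eventually_mem (e.open_source.mem_nhds hp))
    have hgs : ∀ z : ℝ × N × N, z.2.1 ∈ e.source → z.2.2 ∈ e.source →
        ContMDiffAt (𝓘(ℝ).prod ((𝓡 n).prod (𝓡 n))) (𝓡 n) ∞ g z := by
      intro z h1 h2
      have a1 : ContMDiffAt (𝓘(ℝ).prod ((𝓡 n).prod (𝓡 n))) (𝓡 n) ∞
          (fun z : ℝ × N × N => z.2.1) z := contMDiffAt_snd.fst
      have a2 : ContMDiffAt (𝓘(ℝ).prod ((𝓡 n).prod (𝓡 n))) (𝓡 n) ∞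
          (fun z : ℝ × N × N => z.2.2) z := contMDiffAt_snd.snd
      have a0 : ContMDiffAt (𝓘(ℝ).prod ((𝓡 n).prod (𝓡 n))) 𝓘(ℝ) ∞
          (fun z : ℝ × N × N => z.1) z := contMDiffAt_fst
      have b1 := (contMDiffAt_of_mem_maximalAtlas he h1).comp z a1
      have b2 := (contMDiffAt_of_mem_maximalAtlas he h2).comp z a2
      exact b1.add ((a0.mul (hη.contMDiffAt.comp z a1)).smul (b2.sub b1))
    have hgp : g (t, p, p) = e p := by simp [hg]
    have hgt : ∀ᶠ z in 𝓝 (t, p, p), g z ∈ e.target :=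
      (hgs (t, p, p) hp hp).continuousAt (by
        rw [hgp]
        exact e.open_target.mem_nhds (e.map_source hp))
    filter_upwards [hev.eventually_nhds, hgt] with z h1 h2
    have h3 := (contMDiffAt_symm_of_mem_maximalAtlas he h2).comp z
      (hgs z h1.self_of_nhds.1 h1.self_of_nhds.2)
    refine h3.congr_of_eventuallyEq ?_
    filter_upwards [h1] with w hw
    simp only [chartMove, if_pos hw]
    rfl
  · have hp' : p ∉ tsupport η := fun h => hp (hs h)
    have hev : ∀ᶠ z : ℝ × N × N in 𝓝 (t, p, p), z.2.1 ∉ tsupport η :=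
      c1.continuousAt (x := (t, p, p)) ((isClosed_tsupport η).isOpen_compl.mem_nhds hp')
    filter_upwards [hev.eventually_nhds] with z h1
    have h3 : ContMDiffAt (𝓘(ℝ).prod ((𝓡 n).prod (𝓡 n))) (𝓡 n) ∞
      (fun z : ℝ × N × N => z.2.1) z := contMDiffAt_snd.fst
    refine h3.congr_of_eventuallyEq ?_
    filter_upwards [h1] with w hw
    exact chartMove_of_eq_zero _ _ (image_eq_zero_of_notMem_tsupport hw)

end chartMove

/-- Successive moves of `p` towards `q` in the charts `e 0, e 1, …`. -/
noncomputable def chartMoves (e : ℕ → OpenPartialHomeomorph N (EuclideanSpace ℝ (Fin n)))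
    (η : ℕ → N → ℝ) : ℕ → ℝ × N × N → N
  | 0, z => z.2.1
  | i + 1, z => chartMove (e i) (η i) (z.1, chartMoves e η i z, z.2.2)

section chartMoves

variable {e : ℕ → OpenPartialHomeomorph N (EuclideanSpace ℝ (Fin n))} {η : ℕ → N → ℝ}

theorem chartMoves_self (i : ℕ) (t : ℝ) (p : N) : chartMoves e η i (t, p, p) = p := by
  induction i with
  | zero => rfl
  | succ i ih => rw [chartMoves, ih, chartMove_self]

theorem chartMoves_zero (i : ℕ) (p q : N) : chartMoves e η i (0, p, q) = p := by
  induction i with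
  | zero => rfl
  | succ i ih => rw [chartMoves, ih, chartMove_zero]

/-- Each move fixes the diagonal, so smoothness near the diagonal survives composition. -/
theorem eventually_contMDiffAt_chartMoves [IsManifold (𝓡 n) ∞ N]
    (he : ∀ i, e i ∈ IsManifold.maximalAtlas (𝓡 n) ∞ N)
    (hη : ∀ i, ContMDiff (𝓡 n) 𝓘(ℝ) ∞ (η i)) (hs : ∀ i, tsupport (η i) ⊆ (e i).source)
    (i : ℕ) (t : ℝ) (p : N) :
    ∀ᶠ z in 𝓝 (t, p, p),
      ContMDiffAt (𝓘(ℝ).prod ((𝓡 n).prod (𝓡 n))) (𝓡 n) ∞ (chartMoves e η i) z := by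
  induction i with
  | zero => exact Eventually.of_forall fun z => contMDiffAt_snd.fst
  | succ i ih =>
    have hc : ContinuousAt (fun z : ℝ × N × N => (z.1, chartMoves e η i z, z.2.2)) (t, p, p) :=
      continuousAt_fst.prodMk (ih.self_of_nhds.continuousAt.prodMk
        (by fun_prop : Continuous fun z : ℝ × N × N => z.2.2).continuousAt)
    have h1 := eventually_contMDiffAt_chartMove (he i) (hη i) (hs i) t p
    have h2 : (fun z : ℝ × N × N => (z.1, chartMoves e η i z, z.2.2)) (t, p, p) = (t, p, p) := by
      simp only [chartMoves_self]
    rw [← h2] at h1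
    filter_upwards [hc.eventually h1, ih] with z h3 h4
    exact h3.comp z (contMDiffAt_fst.prodMk (h4.prodMk contMDiffAt_snd.snd))

end chartMoves

/-- A smooth interpolation `c(t, p, q)` between nearby points of a manifold. -/
structure IsInterpolation (n : ℕ) {N : Type*} [TopologicalSpace N]
    [ChartedSpace (EuclideanSpace ℝ (Fin n)) N] (c : ℝ × N × N → N) : Prop where
  contMDiffAt : ∀ t p, ∀ᶠ z in 𝓝 (t, p, p),
    ContMDiffAt (𝓘(ℝ).prod ((𝓡 n).prod (𝓡 n))) (𝓡 n) ∞ c z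
  self : ∀ t p, c (t, p, p) = p
  zero : ∀ p q, c (0, p, q) = p
  one : ∀ p, ∀ᶠ z : N × N in 𝓝 (p, p), c (1, z) = z.2

open Classical in
-- The interpolation is the eventual value of the sequence of moves. Near `(t, p, p)` the moves
-- become trivial after a fixed index, by local finiteness of the supports. At `t = 1`, the first
-- bump equal to `1` at the current point carries it exactly to `q`, where all later moves leave it.
theorem exists_isInterpolation [IsManifold (𝓡 n) ∞ N] [T2Space N] [SigmaCompactSpace N]
    [Nonempty N] : ∃ c : ℝ × N × N → N, IsInterpolation n c := by
  obtain ⟨e, η, he, hη, hs, hlf, h1⟩ := exists_bump_sequence (n := n) (N := N)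
  set m := chartMoves e η with hm
  -- The value `z.2.1` for sequences that never stabilize is arbitrary: near the diagonal they all
  -- do.
  set c : ℝ × N × N → N := fun z =>
    if h : ∃ I, ∀ i ≥ I, m i z = m I z then m h.choose z else z.2.1 with hc
  have hcI : ∀ z I, (∀ i ≥ I, m i z = m I z) → c z = m I z := by
    intro z I hI
    have h : ∃ I, ∀ i ≥ I, m i z = m I z := ⟨I, hI⟩
    simp only [hc, dif_pos h]
    rw [← h.choose_spec _ (le_max_left _ I), hI _ (le_max_right _ I)]
  have hsm := eventually_contMDiffAt_chartMoves he hη hs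
  refine ⟨c, fun t p => ?_, fun t p => ?_, fun p q => ?_, fun p => ?_⟩
  · obtain ⟨V, hV, hfin⟩ := hlf p
    obtain ⟨I, hI⟩ := hfin.bddAbove
    have hev : ∀ᶠ z in 𝓝 (t, p, p), m (I + 1) z ∈ V :=
      (hsm (I + 1) t p).self_of_nhds.continuousAt (by rwa [chartMoves_self])
    -- Once the moves `0, …, I` are done and the point is in `V`, no remaining support meets `V`.
    have hcst : ∀ z, m (I + 1) z ∈ V → ∀ i ≥ I + 1, m i z = m (I + 1) z := by
      intro z hz i hi
      induction i, hi using Nat.le_induction with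
      | base => rfl
      | succ i hi ih =>
        rw [hm, chartMoves, ← hm, chartMove_of_eq_zero _ _ ?_, ih]
        rw [ih]
        by_contra h0
        have : i ≤ I := hI ⟨_, subset_tsupport _ h0, hz⟩
        omega
    filter_upwards [hev.eventually_nhds, hsm (I + 1) t p] with z h2 h3
    refine h3.congr_of_eventuallyEq ?_
    filter_upwards [h2] with w hw
    exact hcI w _ (hcst w hw)
  · exact (hcI _ 0 fun i _ => by rw [hm, chartMoves_self, chartMoves_self]).trans rfl
  · exact (hcI _ 0 fun i _ => by rw [hm, chartMoves_zero, chartMoves_zero]).trans rfl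
  · obtain ⟨i, hi⟩ := h1 p
    have hpe : p ∈ (e i).source := hs i (subset_tsupport _ (by simp [hi.self_of_nhds]))
    have hcont : ContinuousAt (fun z : N × N => m i (1, z)) (p, p) :=
      ContinuousAt.comp (f := fun z : N × N => ((1 : ℝ), z))
        (hsm i 1 p).self_of_nhds.continuousAt (by fun_prop)
    have hmp : (fun z : N × N => m i (1, z)) (p, p) = p := chartMoves_self i 1 p
    have hev : ∀ᶠ q in 𝓝 ((fun z : N × N => m i (1, z)) (p, p)), η i q = 1 ∧ q ∈ (e i).source := by
      rw [hmp]
      exact hi.and ((e i).open_source.mem_nhds hpe)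
    have hev2 : ∀ᶠ z : N × N in 𝓝 (p, p), z.2 ∈ (e i).source :=
      continuousAt_snd ((e i).open_source.mem_nhds hpe)
    filter_upwards [hcont.eventually hev, hev2] with z h2 h3
    have key : ∀ j ≥ i + 1, m j (1, z) = z.2 := by
      intro j hj
      induction j, hj using Nat.le_induction with
      | base => exact chartMove_one h2.1 h2.2 h3
      | succ j hj ih =>
        rw [hm, chartMoves, ← hm, ih]
        exact chartMove_self _ _
    rw [hcI _ (i + 1) fun j hj => by rw [key j hj, key _ le_rfl], key _ le_rfl]

end Interpolation

/-! ### Moderateness of interpolated nets. -/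

section InterpolatedNets

variable {m n : ℕ} {M N : Type*}
  [TopologicalSpace M] [ChartedSpace (EuclideanSpace ℝ (Fin m)) M]
  [TopologicalSpace N] [ChartedSpace (EuclideanSpace ℝ (Fin n)) N]

/-- Uniform closeness of two nets on compact sets as `ε → 0`, in terms of neighbourhoods of the
diagonal. -/
def EventuallyNear (u v : Param → M → N) : Prop :=
  ∀ O : Set (N × N), (∀ p, O ∈ 𝓝 (p, p)) → ∀ K : Set M, IsCompact K →
    ∀ᶠ ε in smallParam, ∀ x ∈ K, (u ε x, v ε x) ∈ O

theorem UnifClose.eventuallyNear [IsManifold (𝓡 n) ∞ N] [T2Space N] {h : SmoothMetric n N}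
    {u v : Param → M → N} (H : UnifClose h u v) (hu : IsCBounded u) (hv : IsCBounded v) :
    EventuallyNear u v := by
  intro O hO K hK
  have := (unifClose_iff h hu hv).1 H (interior O) isOpen_interior
    (fun p => mem_interior_iff_mem_nhds.2 (hO p)) K hK
  filter_upwards [eventually_smallParam.2 this] with ε h x hx
  exact interior_subset (h x hx)

/-- Away from the closed set `L` the implication is vacuous. Conditions needed only over a compact
set thereby become neighbourhoods of the whole diagonal, as `EventuallyNear` demands. -/
theorem mem_nhds_diagonal_of_compact {X : Type*} [TopologicalSpace X] [T2Space X] {L : Set X}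
    (hL : IsCompact L) {P : X × X → Prop} (hP : ∀ p ∈ L, ∀ᶠ z in 𝓝 (p, p), P z) (p : X) :
    {z : X × X | z.1 ∈ L → P z} ∈ 𝓝 (p, p) := by
  by_cases hp : p ∈ L
  · exact (hP p hp).mono fun z hz _ => hz
  · filter_upwards [continuousAt_fst.eventually_mem
      (hL.isClosed.isOpen_compl.mem_nhds (show ((p, p) : X × X).1 ∈ Lᶜ from hp))] with z hz h
    exact absurd h hz

theorem IsModerate.eventually_forall_le {u : Param → M → N} (hu : IsModerate m n u) (k : ℕ)
    {φ : OpenPartialHomeomorph M (EuclideanSpace ℝ (Fin m))}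
    (hφ : φ ∈ IsManifold.maximalAtlas (𝓡 m) ∞ M)
    {ψ : OpenPartialHomeomorph N (EuclideanSpace ℝ (Fin n))}
    (hψ : ψ ∈ IsManifold.maximalAtlas (𝓡 n) ∞ N) {L : Set M} (hL : IsCompact L)
    (hLφ : L ⊆ φ.source) {L' : Set N} (hL' : IsCompact L') (hLψ : L' ⊆ ψ.source) :
    ∃ p : ℕ, ∃ C : ℝ, 0 ≤ C ∧ ∀ᶠ ε in smallParam, ∀ x ∈ L, u ε x ∈ L' → ∀ i ≤ k,
      ‖iteratedFDeriv ℝ i (fun y => ψ (u ε (φ.symm y))) (φ x)‖ ≤ C * ((ε : ℝ) ^ p)⁻¹ := by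
  choose p C hC H using fun i => hu.eventually_le i hφ hψ hL hLφ hL' hLψ
  refine ⟨∑ i ∈ Finset.range (k + 1), p i, ∑ i ∈ Finset.range (k + 1), C i,
    Finset.sum_nonneg fun i _ => hC i, ?_⟩
  filter_upwards [(Finset.eventually_all (Finset.range (k + 1))).2 fun i _ => H i]
    with ε h x hx hux i hi
  have hi' : i ∈ Finset.range (k + 1) := by simpa using Nat.lt_succ_of_le hi
  exact (h i hi' x hx hux).trans (mul_inv_pow_le
    (Finset.single_le_sum (f := C) (fun i _ => hC i) hi') (Finset.sum_nonneg fun i _ => hC i)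
    (Finset.single_le_sum (f := p) (fun i _ => Nat.zero_le _) hi') ε)

theorem IsInterpolation.eventually_contDiffAt_chart [IsManifold (𝓡 n) ∞ N] {c : ℝ × N × N → N}
    (hc : IsInterpolation n c) {ψ : OpenPartialHomeomorph N (EuclideanSpace ℝ (Fin n))}
    (hψ : ψ ∈ IsManifold.maximalAtlas (𝓡 n) ∞ N) (t : ℝ) {p : N} (hp : p ∈ ψ.source) :
    ∀ᶠ z in 𝓝 (t, ψ p, ψ p), ContDiffAt ℝ ∞
      (fun z : ℝ × EuclideanSpace ℝ (Fin n) × EuclideanSpace ℝ (Fin n) =>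
        ψ (c (z.1, ψ.symm z.2.1, ψ.symm z.2.2))) z := by
  set E := EuclideanSpace ℝ (Fin n)
  have c1 : Continuous fun z : ℝ × E × E => z.2.1 := by fun_prop
  have c2 : Continuous fun z : ℝ × E × E => z.2.2 := by fun_prop
  set θ : ℝ × E × E → ℝ × N × N := fun z => (z.1, ψ.symm z.2.1, ψ.symm z.2.2) with hθ
  have hθs : ∀ z : ℝ × E × E, z.2.1 ∈ ψ.target → z.2.2 ∈ ψ.target →
      ContMDiffAt 𝓘(ℝ, ℝ × E × E) (𝓘(ℝ).prod ((𝓡 n).prod (𝓡 n))) ∞ θ z := by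
    intro z h1 h2
    have a0 : ContMDiffAt 𝓘(ℝ, ℝ × E × E) 𝓘(ℝ) ∞ (fun z : ℝ × E × E => z.1) z :=
      contDiff_fst.contMDiff.contMDiffAt
    have a1 : ContMDiffAt 𝓘(ℝ, ℝ × E × E) (𝓡 n) ∞ (fun z : ℝ × E × E => z.2.1) z :=
      (contDiff_fst.comp contDiff_snd).contMDiff.contMDiffAt
    have a2 : ContMDiffAt 𝓘(ℝ, ℝ × E × E) (𝓡 n) ∞ (fun z : ℝ × E × E => z.2.2) z :=
      (contDiff_snd.comp contDiff_snd).contMDiff.contMDiffAt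
    exact a0.prodMk (((contMDiffAt_symm_of_mem_maximalAtlas hψ h1).comp z a1).prodMk
      ((contMDiffAt_symm_of_mem_maximalAtlas hψ h2).comp z a2))
  have hpt := ψ.map_source hp
  have hθp : θ (t, ψ p, ψ p) = (t, p, p) := by simp only [hθ, ψ.left_inv hp]
  have hθc : ContinuousAt θ (t, ψ p, ψ p) := (hθs (t, ψ p, ψ p) hpt hpt).continuousAt
  have h1 : ∀ᶠ z in 𝓝 (t, ψ p, ψ p),
      ContMDiffAt (𝓘(ℝ).prod ((𝓡 n).prod (𝓡 n))) (𝓡 n) ∞ c (θ z) :=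
    hθc.eventually (by rw [hθp]; exact hc.contMDiffAt t p)
  have h2 : ∀ᶠ z in 𝓝 (t, ψ p, ψ p), c (θ z) ∈ ψ.source := by
    have h3 : ∀ᶠ w in 𝓝 (t, p, p), c w ∈ ψ.source :=
      (hc.contMDiffAt t p).self_of_nhds.continuousAt.eventually_mem
        (by rw [hc.self]; exact ψ.open_source.mem_nhds hp)
    exact hθc.eventually (by rwa [hθp])
  filter_upwards [h1, h2, c1.continuousAt.eventually_mem (ψ.open_target.mem_nhds hpt),
    c2.continuousAt.eventually_mem (ψ.open_target.mem_nhds hpt)] with z h1 h2 h3 h4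
  exact contMDiffAt_iff_contDiffAt.1
    ((contMDiffAt_of_mem_maximalAtlas hψ h2).comp z (h1.comp z (hθs z h3 h4)))

/-- A net obtained by interpolating between two moderate nets is moderate. -/
theorem IsInterpolation.isModerate [IsManifold (𝓡 n) ∞ N] [T2Space N] {c : ℝ × N × N → N}
    (hc : IsInterpolation n c) {A B g : Param → M → N} (hA : A ∈ moderateNets m n M N)
    (hB : B ∈ moderateNets m n M N) (hAB : EventuallyNear A B) (hgA : EventuallyNear g A)
    {τ : Param → ℝ} (hτ : ∀ ε, τ ε ∈ Icc (0 : ℝ) 1)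
    (hg : ∀ K : Set M, IsCompact K → ∀ᶠ ε in smallParam, ∀ x ∈ K,
      g ε =ᶠ[𝓝 x] fun x' => c (τ ε, A ε x', B ε x')) :
    IsModerate m n g := by
  have := Manifold.locallyCompact_of_finiteDimensional (M := N) (𝓡 n)
  intro k φ hφ ψ hψ L hL hLφ L' hL' hLψ
  set E := EuclideanSpace ℝ (Fin n)
  -- Nested compact sets: for small `ε`, `g ε x ∈ L'` forces `A ε x ∈ L₂`, which in turn forces `B ε
  -- x ∈ L₃`.
  obtain ⟨L₂, hL₂, hLL₂, hL₂ψ⟩ := exists_compact_between hL' ψ.open_source hLψ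
  obtain ⟨L₃, hL₃, hLL₃, hL₃ψ⟩ := exists_compact_between hL₂ ψ.open_source hL₂ψ
  set Ψ : ℝ × E × E → E := fun z => ψ (c (z.1, ψ.symm z.2.1, ψ.symm z.2.2)) with hΨ
  -- In the chart, `c` is one fixed function `Ψ`, smooth near `[0,1]` times the diagonal over `L₂`.
  -- Its derivatives are bounded on a neighbourhood `Ω` independent of `ε`, so only the inner
  -- derivatives grow.
  have hKc : IsCompact (Icc (0 : ℝ) 1 ×ˢ ((fun p => (ψ p, ψ p)) '' L₂)) := by
    refine isCompact_Icc.prod (hL₂.image_of_continuousOn ?_)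
    exact (ψ.continuousOn.mono hL₂ψ).prodMk (ψ.continuousOn.mono hL₂ψ)
  obtain ⟨C, hC, Ω, hΩ, hKΩ, hΩs, hΩb⟩ := exists_isOpen_norm_iteratedFDeriv_le (g := Ψ) hKc (by
    rintro ⟨t, z⟩ ⟨ht, p, hp, rfl⟩
    exact hc.eventually_contDiffAt_chart hψ t (hL₂ψ hp)) k
  have n1 := hgA {z | z.1 ∈ L' → z.2 ∈ L₂} (mem_nhds_diagonal_of_compact hL' fun p hp =>
    continuousAt_snd.eventually_mem (mem_interior_iff_mem_nhds.1 (hLL₂ hp))) L hL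
  have n2 := hAB {z | z.1 ∈ L₂ → z.2 ∈ L₃} (mem_nhds_diagonal_of_compact hL₂ fun p hp =>
    continuousAt_snd.eventually_mem (mem_interior_iff_mem_nhds.1 (hLL₃ hp))) L hL
  have n3 := hAB {z | z.1 ∈ L₂ → ∀ t ∈ Icc (0 : ℝ) 1, (t, ψ z.1, ψ z.2) ∈ Ω}
    (mem_nhds_diagonal_of_compact (P := fun z => ∀ t ∈ Icc (0 : ℝ) 1, (t, ψ z.1, ψ z.2) ∈ Ω)
      hL₂ fun p hp => by
    refine isCompact_Icc.eventually_forall_of_forall_eventually fun t ht => ?_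
    have hψp := ψ.continuousAt (hL₂ψ hp)
    have : ContinuousAt (fun w : (N × N) × ℝ => (w.2, ψ w.1.1, ψ w.1.2)) ((p, p), t) := by
      refine continuousAt_snd.prodMk (ContinuousAt.prodMk ?_ ?_)
      · exact ContinuousAt.comp (f := fun w : (N × N) × ℝ => w.1.1) hψp (by fun_prop)
      · exact ContinuousAt.comp (f := fun w : (N × N) × ℝ => w.1.2) hψp (by fun_prop)
    exact this.eventually_mem (hΩ.mem_nhds (hKΩ ⟨ht, p, hp, rfl⟩))) L hL
  obtain ⟨p₁, C₁, hC₁, H₁⟩ := hA.2.2.eventually_forall_le k hφ hψ hL hLφ hL₂ hL₂ψ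
  obtain ⟨p₂, C₂, hC₂, H₂⟩ := hB.2.2.eventually_forall_le k hφ hψ hL hLφ hL₃ hL₃ψ
  set P := p₁ + p₂
  refine ⟨P * k, k.factorial * C * (1 + C₁ + C₂) ^ k, eventually_smallParam.1 ?_⟩
  filter_upwards [n1, n2, n3, H₁, H₂, hg L hL] with ε n1 n2 n3 H₁ H₂ hg x hx hgx
  have hAx : A ε x ∈ L₂ := n1 x hx hgx
  have hBx : B ε x ∈ L₃ := n2 x hx hAx
  have hφx := hLφ hx
  have hε : 0 < (ε : ℝ) := ε.2.1
  set f : EuclideanSpace ℝ (Fin m) → ℝ × E × E :=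
    fun y => (τ ε, ψ (A ε (φ.symm y)), ψ (B ε (φ.symm y))) with hf
  have hx0 : φ.symm (φ x) = x := φ.left_inv hφx
  have hφs : Tendsto φ.symm (𝓝 (φ x)) (𝓝 x) := by
    have := (φ.continuousAt_symm (φ.map_source hφx)).tendsto
    rwa [hx0] at this
  have hEq : (fun y => ψ (g ε (φ.symm y))) =ᶠ[𝓝 (φ x)] Ψ ∘ f := by
    have hAs : ∀ᶠ x' in 𝓝 x, A ε x' ∈ ψ.source :=
      (hA.1 ε).continuous.continuousAt.eventually_mem (ψ.open_source.mem_nhds (hL₂ψ hAx))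
    have hBs : ∀ᶠ x' in 𝓝 x, B ε x' ∈ ψ.source :=
      (hB.1 ε).continuous.continuousAt.eventually_mem (ψ.open_source.mem_nhds (hL₃ψ hBx))
    filter_upwards [hφs.eventually (hg x hx), hφs.eventually hAs, hφs.eventually hBs]
      with y h1 h2 h3
    simp only [Function.comp_apply, hΨ, hf, h1, ψ.left_inv h2, ψ.left_inv h3]
  rw [(Filter.EventuallyEq.iteratedFDeriv ℝ hEq k).eq_of_nhds]
  have hfA : ∀ i : ℕ, ContDiffAt ℝ i (fun y => ψ (A ε (φ.symm y))) (φ x) :=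
    contDiffAt_chart (hA.1 ε) hφ hψ hφx (hL₂ψ hAx)
  have hfB : ∀ i : ℕ, ContDiffAt ℝ i (fun y => ψ (B ε (φ.symm y))) (φ x) :=
    contDiffAt_chart (hB.1 ε) hφ hψ hφx (hL₃ψ hBx)
  have hfx : f (φ x) ∈ Ω := by
    simp only [hf, hx0]
    exact n3 x hx hAx _ (hτ ε)
  -- The summand `1` makes `D ≥ 1`, so that `D ≤ D ^ i` as the composition estimate requires. The
  -- time `τ ε` is constant in `x` and contributes nothing.
  set D := (1 + C₁ + C₂) * ((ε : ℝ) ^ P)⁻¹ with hD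
  have hD1 : 1 ≤ D := by
    have h1 : 1 ≤ ((ε : ℝ) ^ P)⁻¹ := (one_le_inv₀ (by positivity)).2 (pow_le_one₀ hε.le ε.2.2)
    nlinarith
  have key := norm_iteratedFDeriv_comp_le_of_contDiffOn (g := Ψ) (f := f) (k := k) (C := C) (D := D)
    hΩ (fun z hz => ((hΩs z hz).of_le (by exact_mod_cast le_top)).contDiffWithinAt)
    (contDiffAt_const.prodMk ((hfA k).prodMk (hfB k))) hfx (hΩb _ hfx) (fun i hi hik => by
      rw [hf, iteratedFDeriv_prodMk (n := i) contDiffAt_const ((hfA i).prodMk (hfB i)) le_rfl,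
        ContinuousMultilinearMap.opNorm_prod,
        iteratedFDeriv_prodMk (n := i) (hfA i) (hfB i) le_rfl,
        ContinuousMultilinearMap.opNorm_prod, iteratedFDeriv_const_of_ne (by omega)]
      have h1 := H₁ x hx hAx i hik
      have h2 := H₂ x hx hBx i hik
      have h3 : D ≤ D ^ i := le_self_pow₀ hD1 (by omega)
      refine (max_le ?_ (max_le ?_ ?_)).trans h3
      · simpa using zero_le_one.trans hD1
      · exact h1.trans (mul_inv_pow_le (by linarith) (by linarith) (by omega) ε)
      · exact h2.trans (mul_inv_pow_le (by linarith) (by linarith) (by omega) ε))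
  refine key.trans (le_of_eq ?_)
  rw [hD, mul_pow, inv_pow, ← pow_mul]
  ring

end InterpolatedNets

/-! ### The variable `s = 1/ε`: choice of nodes, smooth threshold and blending. -/

section SmoothInterpolation

theorem toParam_coe (ε : Param) : toParam (ε : ℝ) = ε := by simp [toParam]

theorem coe_toParam_inv {s : ℝ} (hs : 1 ≤ s) : (toParam s⁻¹ : ℝ) = s⁻¹ := by
  have h : s⁻¹ ∈ Ioc (0 : ℝ) 1 := ⟨by positivity, inv_le_one_of_one_le₀ hs⟩
  simp only [toParam, dif_pos h]

theorem continuousAt_toParam_inv {s : ℝ} (hs : 1 < s) :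
    ContinuousAt (fun s : ℝ => toParam s⁻¹) s := by
  rw [Topology.IsInducing.subtypeVal.continuousAt_iff]
  have h0 : ContinuousAt (fun s : ℝ => s⁻¹) s := continuousAt_inv₀ (by linarith)
  refine h0.congr ?_
  filter_upwards [lt_mem_nhds hs] with r hr
  exact (coe_toParam_inv hr.le).symm

/-- A sequence tending to infinity whose steps are bounded by a prescribed function. -/
theorem exists_strictMono_small_steps (d : ℕ → ℝ) (hd : ∀ j, 0 < d j) :
    ∃ a : ℕ → ℝ, a 0 = 1 ∧ StrictMono a ∧ Tendsto a atTop atTop ∧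
      ∀ k, a (k + 1) ≤ a k + 1 ∧ a (k + 1) ≤ a k + d ⌈a k⌉₊ := by
  set a : ℕ → ℝ := fun k => Nat.rec 1 (fun _ s => s + min 1 (d ⌈s⌉₊)) k with ha
  have hs : ∀ k, a (k + 1) = a k + min 1 (d ⌈a k⌉₊) := fun k => rfl
  have hmono : StrictMono a := strictMono_nat_of_lt_succ fun k => by
    rw [hs]
    have : 0 < min 1 (d ⌈a k⌉₊) := lt_min one_pos (hd _)
    linarith
  refine ⟨a, rfl, hmono, ?_, fun k => ⟨?_, ?_⟩⟩
  · refine tendsto_atTop_atTop_of_monotone hmono.monotone fun B => ?_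
    -- A bounded sequence would use only the finitely many values `d j` with `j ≤ ⌈B⌉₊`, so its
    -- steps would be bounded below.
    by_contra! hB
    obtain ⟨j, -, hj⟩ := (Finset.range (⌈B⌉₊ + 1)).exists_min_image d ⟨0, by simp⟩
    have hδ : 0 < min 1 (d j) := lt_min one_pos (hd _)
    have hlow : ∀ k : ℕ, 1 + k * min 1 (d j) ≤ a k := by
      intro k
      induction k with
      | zero => simp [ha]
      | succ k ih =>
        rw [hs]
        have h1 : d j ≤ d ⌈a k⌉₊ := hj _ (by
          simpa using Nat.lt_succ_of_le (Nat.ceil_le_ceil (hB k).le))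
        have h2 : min 1 (d j) ≤ min 1 (d ⌈a k⌉₊) := min_le_min_left _ h1
        push_cast
        linarith
    obtain ⟨k, hk⟩ := exists_nat_gt (B / min 1 (d j))
    rw [div_lt_iff₀ hδ] at hk
    linarith [hlow k, hB k]
  · rw [hs]
    linarith [min_le_left 1 (d ⌈a k⌉₊)]
  · rw [hs]
    linarith [min_le_right 1 (d ⌈a k⌉₊)]

variable {m n : ℕ} {M N : Type*}
  [TopologicalSpace M] [ChartedSpace (EuclideanSpace ℝ (Fin m)) M]
  [TopologicalSpace N] [ChartedSpace (EuclideanSpace ℝ (Fin n)) N]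

/-- A smooth proper function `S` such that `(s, x) ↦ u_{1/s}(x)` is continuous at all points with
`S(x) ≤ s`. -/
theorem exists_smooth_threshold [IsManifold (𝓡 m) ∞ M] [T2Space M] [SecondCountableTopology M]
    [IsManifold (𝓡 n) ∞ N] [T2Space N] {u : Param → M → N} (hu : u ∈ moderateNetsCo m n M N) :
    ∃ S : M → ℝ, ContMDiff (𝓡 m) 𝓘(ℝ) ∞ S ∧ (∀ x, 2 ≤ S x) ∧ (∀ r, IsCompact {x | S x ≤ r}) ∧
      ∀ x s, S x ≤ s → ContinuousAt (fun z : ℝ × M => u (toParam z.1⁻¹) z.2) (s, x) := by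
  have := Manifold.locallyCompact_of_finiteDimensional (M := M) (𝓡 m)
  set K := CompactExhaustion.choice M
  -- The admissible thresholds at `y` form an up-set, hence a convex set, so a partition of unity
  -- selects one smoothly. The condition on the exhaustion `K` is what makes `S` proper.
  set t : M → Set ℝ := fun y => {c | 2 ≤ c ∧ (∀ j : ℕ, y ∉ K j → (j : ℝ) ≤ c) ∧
    ∀ s, c ≤ s → ContinuousAt (fun z : ℝ × M => u (toParam z.1⁻¹) z.2) (s, y)} with ht
  have hconv : ∀ y, Convex ℝ (t y) := by
    intro y
    refine OrdConnected.convex (IsUpperSet.ordConnected ?_)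
    rintro c c' hcc ⟨h1, h2, h3⟩
    exact ⟨h1.trans hcc, fun j hj => (h2 j hj).trans hcc, fun s hs => h3 s (hcc.trans hs)⟩
  obtain ⟨S, hS⟩ := exists_contMDiffMap_forall_mem_convex_of_local_const (𝓡 m) (n := ⊤) hconv
    (fun x => by
      obtain ⟨V, hV, hev⟩ := exists_nhds_eventually_continuousAt hu x
      obtain ⟨ε₀, hε₀, hc⟩ := eventually_smallParam.1 hev
      obtain ⟨j, hj⟩ := K.exists_mem_nhds x
      refine ⟨2 + j + ε₀⁻¹, ?_⟩
      have hinv : 0 < ε₀⁻¹ := by positivity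
      have hj0 : (0 : ℝ) ≤ j := by positivity
      filter_upwards [hV, hj] with y hyV hyj
      refine ⟨by linarith, fun i hi => ?_, fun s hs => ?_⟩
      · have : i < j := by
          by_contra! hij
          exact hi (K.subset hij hyj)
        have : (i : ℝ) < j := by exact_mod_cast this
        linarith
      · have hs1 : 1 < s := by linarith
        have hlt : (toParam s⁻¹ : ℝ) < ε₀ := by
          rw [coe_toParam_inv hs1.le]
          exact inv_lt_of_inv_lt₀ hε₀ (by linarith)
        exact ContinuousAt.comp (f := fun z : ℝ × M => (toParam z.1⁻¹, z.2)) (hc _ hlt y hyV)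
          ((ContinuousAt.comp (x := (s, y)) (g := fun s : ℝ => toParam s⁻¹)
            (f := fun z : ℝ × M => z.1) (continuousAt_toParam_inv hs1)
            continuousAt_fst).prodMk continuousAt_snd))
  refine ⟨S, S.contMDiff, fun x => (hS x).1, fun r => ?_, fun x s hs => (hS x).2.2 s hs⟩
  obtain ⟨j, hj⟩ := exists_nat_gt r
  refine (K.isCompact j).of_isClosed_subset
    (isClosed_le S.contMDiff.continuous continuous_const) fun x hx => ?_
  by_contra h
  have := (hS x).2.1 j h
  have hx' : S x ≤ r := hx
  linarith

/-- For step zero all three properties reduce to the behaviour of `c` and `G` at the diagonal point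
`U s x`, and they persist nearby by joint continuity. The triples `(s, x, t)` with `S x ≤ s ≤ r`
form a compact set because `S` is proper and at least `2`, so one step size suffices. Here `α` leads
to the next node and `β` to the time of comparison. -/
theorem IsInterpolation.exists_step {c : ℝ × N × N → N} (hc : IsInterpolation n c) {U : ℝ → M → N}
    {S : M → ℝ} (hS : Continuous S) (hS2 : ∀ x, 2 ≤ S x) (hSc : ∀ r, IsCompact {x | S x ≤ r})
    (hU : ∀ x s, S x ≤ s → ContinuousAt (fun z : ℝ × M => U z.1 z.2) (s, x))
    {G : Set (N × N)} (hG : ∀ p, G ∈ 𝓝 (p, p)) (r : ℝ) :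
    ∃ d > 0, ∀ s ≤ r, ∀ x, S x ≤ s → ∀ t ∈ Icc (0 : ℝ) 1, ∀ α ∈ Icc 0 d, ∀ β ∈ Icc 0 d,
      ContMDiffAt (𝓘(ℝ).prod ((𝓡 n).prod (𝓡 n))) (𝓡 n) ∞ c (t, U s x, U (s + α) x) ∧
      (c (t, U s x, U (s + α) x), U (s + β) x) ∈ G ∧
      c (1, U s x, U (s + α) x) = U (s + α) x := by
  have hK : IsCompact {y : ℝ × M × ℝ | y.1 ∈ Icc 2 r ∧ S y.2.1 ≤ y.1 ∧ y.2.2 ∈ Icc (0 : ℝ) 1} := by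
    refine (isCompact_Icc.prod ((hSc r).prod isCompact_Icc)).of_isClosed_subset ?_
      (fun y hy => ⟨hy.1, hy.2.1.trans hy.1.2, hy.2.2⟩)
    exact (isClosed_Icc.preimage continuous_fst).inter ((isClosed_le (by fun_prop) continuous_fst).inter
      (isClosed_Icc.preimage (by fun_prop : Continuous fun y : ℝ × M × ℝ => y.2.2)))
  have key := hK.eventually_forall_of_forall_eventually (x₀ := ((0 : ℝ), (0 : ℝ)))
    (P := fun a y => ContMDiffAt (𝓘(ℝ).prod ((𝓡 n).prod (𝓡 n))) (𝓡 n) ∞ c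
        (y.2.2, U y.1 y.2.1, U (y.1 + a.1) y.2.1) ∧
      (c (y.2.2, U y.1 y.2.1, U (y.1 + a.1) y.2.1), U (y.1 + a.2) y.2.1) ∈ G ∧
      c (1, U y.1 y.2.1, U (y.1 + a.1) y.2.1) = U (y.1 + a.1) y.2.1) (by
    rintro ⟨s, x, t⟩ ⟨-, hx, -⟩
    have hUc : ∀ f : (ℝ × ℝ) × ℝ × M × ℝ → ℝ, Continuous f → f ((0, 0), s, x, t) = s →
        ContinuousAt (fun w : (ℝ × ℝ) × ℝ × M × ℝ => U (f w) w.2.2.1) ((0, 0), s, x, t) := by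
      intro f hf hfs
      refine ContinuousAt.comp (g := fun z : ℝ × M => U z.1 z.2)
        (f := fun w : (ℝ × ℝ) × ℝ × M × ℝ => (f w, w.2.2.1)) ?_ (by fun_prop)
      rw [hfs]
      exact hU x s hx
    have u0 := hUc (fun w => w.2.1) (by fun_prop) rfl
    have u1 := hUc (fun w => w.2.1 + w.1.1) (by fun_prop) (add_zero s)
    have u2 := hUc (fun w => w.2.1 + w.1.2) (by fun_prop) (add_zero s)
    have v : ContinuousAt (fun w : (ℝ × ℝ) × ℝ × M × ℝ =>
        (w.2.2.2, U w.2.1 w.2.2.1, U (w.2.1 + w.1.1) w.2.2.1)) ((0, 0), s, x, t) :=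
      (by fun_prop : Continuous fun w : (ℝ × ℝ) × ℝ × M × ℝ => w.2.2.2).continuousAt.prodMk
        (u0.prodMk u1)
    have v0 : (fun w : (ℝ × ℝ) × ℝ × M × ℝ =>
        (w.2.2.2, U w.2.1 w.2.2.1, U (w.2.1 + w.1.1) w.2.2.1)) ((0, 0), s, x, t)
        = (t, U s x, U s x) := by simp
    have e1 := v.eventually (by rw [v0]; exact hc.contMDiffAt t (U s x))
    have w1 : ContinuousAt (fun w : (ℝ × ℝ) × ℝ × M × ℝ =>
        c (w.2.2.2, U w.2.1 w.2.2.1, U (w.2.1 + w.1.1) w.2.2.1)) ((0, 0), s, x, t) :=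
      ContinuousAt.comp (g := c) (by
        simpa only [add_zero] using (hc.contMDiffAt t (U s x)).self_of_nhds.continuousAt) v
    have e2 := (w1.prodMk u2).eventually_mem (s := G) (by
      simpa only [add_zero, hc.self] using hG (U s x))
    have e3 := (u0.prodMk u1).eventually (p := fun z : N × N => c (1, z) = z.2) (by
      simpa only [add_zero] using hc.one (U s x))
    filter_upwards [e1, e2, e3] with w h1 h2 h3
    exact ⟨h1, h2, h3⟩)
  obtain ⟨d, hd, hball⟩ := Metric.eventually_nhds_iff.1 key
  refine ⟨d / 2, half_pos hd, fun s hs x hx t ht α hα β hβ => ?_⟩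
  refine hball (y := (α, β)) ?_ (s, x, t) ⟨⟨(hS2 x).trans hx, hs⟩, hx, ht⟩
  rw [Prod.dist_eq, max_lt_iff, Real.dist_eq, Real.dist_eq, sub_zero, sub_zero,
    abs_of_nonneg hα.1, abs_of_nonneg hβ.1]
  exact ⟨by linarith [hα.2], by linarith [hβ.2]⟩

/-- Position between `a` and `b`, as a smooth function which is `0` near `a` and `1` near `b`. -/
noncomputable def transition (a b s : ℝ) : ℝ :=
  Real.smoothTransition (3 * ((s - a) / (b - a)) - 1)

theorem transition_mem_Icc (a b s : ℝ) : transition a b s ∈ Icc (0 : ℝ) 1 :=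
  ⟨Real.smoothTransition.nonneg _, Real.smoothTransition.le_one _⟩

theorem transition_eq_zero {a b s : ℝ} (hab : a < b) (hs : s ≤ a + (b - a) / 3) :
    transition a b s = 0 := by
  refine Real.smoothTransition.zero_of_nonpos ?_
  have : (s - a) / (b - a) ≤ 1 / 3 := by
    rw [div_le_iff₀ (by linarith)]
    linarith
  linarith

theorem transition_eq_one {a b s : ℝ} (hab : a < b) (hs : b - (b - a) / 3 ≤ s) :
    transition a b s = 1 := by
  refine Real.smoothTransition.one_of_one_le ?_
  have : 2 / 3 ≤ (s - a) / (b - a) := by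
    rw [le_div_iff₀ (by linarith)]
    linarith
  linarith

theorem contDiff_transition (a b : ℝ) : ContDiff ℝ ∞ (transition a b) := by
  refine Real.smoothTransition.contDiff.comp ?_
  fun_prop

/-- Interpolation between successive members of a sequence of maps `v k`, placed at times `a k`;
`idx s` is the index with `a (idx s) ≤ s < a (idx s + 1)`. -/
noncomputable def blend (c : ℝ × N × N → N) (a : ℕ → ℝ) (idx : ℝ → ℕ) (v : ℕ → M → N)
    (z : ℝ × M) : N :=
  c (transition (a (idx z.1)) (a (idx z.1 + 1)) z.1, v (idx z.1) z.2, v (idx z.1 + 1) z.2)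

/-- Between nodes the blend is a composite of smooth maps. Near a node the transition function is
constantly `1` on the left and `0` on the right, so the blend is just the map attached to that node.
-/
theorem IsInterpolation.contMDiffAt_blend {c : ℝ × N × N → N} (hc : IsInterpolation n c)
    {a : ℕ → ℝ} (ha : StrictMono a) {idx : ℝ → ℕ}
    (hidx : ∀ s, a 0 ≤ s → a (idx s) ≤ s ∧ s < a (idx s + 1)) {v : ℕ → M → N}
    (hv : ∀ k, ContMDiff (𝓡 m) (𝓡 n) ∞ (v k)) {s : ℝ} {x : M} (hs : a 0 < s)
    (h : ∀ k, a k ≤ s → s ≤ a (k + 1) → ∀ᶠ x' in 𝓝 x, (∀ t ∈ Icc (0 : ℝ) 1,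
      ContMDiffAt (𝓘(ℝ).prod ((𝓡 n).prod (𝓡 n))) (𝓡 n) ∞ c (t, v k x', v (k + 1) x')) ∧
      c (1, v k x', v (k + 1) x') = v (k + 1) x') :
    ContMDiffAt (𝓘(ℝ).prod (𝓡 m)) (𝓡 n) ∞ (blend c a idx v) (s, x) := by
  have huniq : ∀ r k, a k ≤ r → r < a (k + 1) → idx r = k := by
    intro r k h1 h2
    obtain ⟨h3, h4⟩ := hidx r ((ha.monotone (Nat.zero_le k)).trans h1)
    have h5 := ha.lt_iff_lt.1 (h1.trans_lt h4)
    have h6 := ha.lt_iff_lt.1 (h3.trans_lt h2)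
    omega
  obtain ⟨h1, h2⟩ := hidx s hs.le
  set k := idx s
  have hfst : ContinuousAt (fun z : ℝ × M => z.1) (s, x) := continuousAt_fst
  have hsnd : ContinuousAt (fun z : ℝ × M => z.2) (s, x) := continuousAt_snd
  have hvs : ∀ j, ContMDiffAt (𝓘(ℝ).prod (𝓡 m)) (𝓡 n) ∞ (fun z : ℝ × M => v j z.2) (s, x) :=
    fun j => (hv j).contMDiffAt.comp (s, x) contMDiffAt_snd
  rcases h1.lt_or_eq with h1 | h1
  · have hT : ContMDiffAt (𝓘(ℝ).prod (𝓡 m)) 𝓘(ℝ) ∞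
        (fun z : ℝ × M => transition (a k) (a (k + 1)) z.1) (s, x) :=
      (contDiff_transition _ _).contMDiff.contMDiffAt.comp (s, x) contMDiffAt_fst
    have key := ((h k h1.le h2.le).self_of_nhds.1 _ (transition_mem_Icc (a k) (a (k + 1)) s)).comp
      (s, x) (f := fun z : ℝ × M => (transition (a k) (a (k + 1)) z.1, v k z.2, v (k + 1) z.2))
      (hT.prodMk ((hvs k).prodMk (hvs (k + 1))))
    refine key.congr_of_eventuallyEq ?_
    filter_upwards [hfst.eventually (lt_mem_nhds h1), hfst.eventually (gt_mem_nhds h2)]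
      with z hz1 hz2
    simp only [blend, huniq z.1 k hz1.le hz2, Function.comp_apply]
  -- At a node, strictness of `a 0 < s` guarantees an interval to the left.
  · obtain ⟨j, hj⟩ : ∃ j, k = j + 1 := Nat.exists_eq_succ_of_ne_zero (by
      rintro h0
      rw [h0] at h1
      exact hs.ne h1)
    rw [hj] at h1 h2
    have hlt1 : a j < a (j + 1) := ha (Nat.lt_succ_self j)
    have hlt2 : a (j + 1) < a (j + 1 + 1) := ha (Nat.lt_succ_self _)
    refine (hvs (j + 1)).congr_of_eventuallyEq ?_
    filter_upwards [hfst.eventually (lt_mem_nhds (show a (j + 1) - (a (j + 1) - a j) / 3 < s by linarith)),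
      hfst.eventually (gt_mem_nhds (show s < a (j + 1) + (a (j + 1 + 1) - a (j + 1)) / 3 by linarith)),
      hsnd.eventually (h j (by linarith) h1.ge)] with z hz1 hz2 hz3
    rcases lt_or_ge z.1 (a (j + 1)) with hz | hz
    · rw [blend, huniq z.1 j (by linarith) hz, transition_eq_one hlt1 hz1.le, hz3.2]
    · rw [blend, huniq z.1 (j + 1) hz (by linarith), transition_eq_zero hlt2 hz2.le, hc.zero]

end SmoothInterpolation

/-! ### Construction of the smooth net and proof of equivalence. -/

section Construction

variable {m n : ℕ} {M N : Type*}
  [TopologicalSpace M] [ChartedSpace (EuclideanSpace ℝ (Fin m)) M]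
  [TopologicalSpace N] [ChartedSpace (EuclideanSpace ℝ (Fin n)) N]

/-- Given neighbourhoods `G j` of the diagonal, a net that is continuous in `ε` is approximated by a
net that is smooth in `(ε, x)` and interpolates between members of the given net. -/
theorem IsInterpolation.exists_smooth_net [IsManifold (𝓡 m) ∞ M] [T2Space M]
    [SecondCountableTopology M] [IsManifold (𝓡 n) ∞ N] [T2Space N] {c : ℝ × N × N → N}
    (hc : IsInterpolation n c) {u : Param → M → N} (hu : u ∈ moderateNetsCo m n M N)
    {G : ℕ → Set (N × N)} (hG : ∀ j p, G j ∈ 𝓝 (p, p)) :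
    ∃ (g : Param → M → N) (a b : Param → Param) (τ : Param → ℝ),
      ContMDiffOn (𝓘(ℝ, ℝ).prod (𝓡 m)) (𝓡 n) ∞
        (fun z : ℝ × M => g (toParam z.1) z.2) (Ioc (0 : ℝ) 1 ×ˢ univ) ∧
      (∀ ε, ContMDiff (𝓡 m) (𝓡 n) ∞ (g ε)) ∧
      (∀ ε, (a ε : ℝ) ≤ 2 * ε) ∧ (∀ ε : Param, (ε : ℝ) ≤ 2 * a ε) ∧
      (∀ ε, (b ε : ℝ) ≤ 2 * ε) ∧ (∀ ε : Param, (ε : ℝ) ≤ 2 * b ε) ∧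
      (∀ ε, τ ε ∈ Icc (0 : ℝ) 1) ∧
      ∀ K : Set M, IsCompact K → ∀ᶠ ε : Param in smallParam, ∀ x ∈ K,
        (g ε =ᶠ[𝓝 x] fun x' => c (τ ε, u (a ε) x', u (b ε) x')) ∧
        ∃ j : ℕ, (ε : ℝ)⁻¹ ≤ j + 1 ∧ (g ε x, u ε x) ∈ G j ∧ (g ε x, u (a ε) x) ∈ G j ∧
          (u (a ε) x, u (b ε) x) ∈ G j := by
  obtain ⟨S, hSs, hS2, hSc, hSU⟩ := exists_smooth_threshold hu
  set U : ℝ → M → N := fun s => u (toParam s⁻¹) with hU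
  choose d hd0 hd using fun j : ℕ =>
    hc.exists_step hSs.continuous hS2 hSc (U := U) hSU (hG j) (j : ℝ)
  obtain ⟨a, ha0, ha, hat, hstep⟩ := exists_strictMono_small_steps d hd0
  have ha1 : ∀ k, 1 ≤ a k := fun k => ha0 ▸ ha.monotone (Nat.zero_le k)
  have hgood : ∀ k x, S x ≤ a k → ∀ t ∈ Icc (0 : ℝ) 1, ∀ σ ∈ Icc (a k) (a (k + 1)),
      ContMDiffAt (𝓘(ℝ).prod ((𝓡 n).prod (𝓡 n))) (𝓡 n) ∞ c (t, U (a k) x, U (a (k + 1)) x) ∧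
      (c (t, U (a k) x, U (a (k + 1)) x), U σ x) ∈ G ⌈a k⌉₊ ∧
      c (1, U (a k) x, U (a (k + 1)) x) = U (a (k + 1)) x := by
    intro k x hx t ht σ hσ
    have h2 := (hstep k).2
    have h3 := ha (Nat.lt_succ_self k)
    have := hd ⌈a k⌉₊ (a k) (Nat.le_ceil _) x hx t ht (a (k + 1) - a k)
      ⟨by linarith, by linarith⟩ (σ - a k) ⟨by linarith [hσ.1], by linarith [hσ.2]⟩
    simpa only [add_sub_cancel] using this
  have hex : ∀ s, ∃ k, a 0 ≤ s → a k ≤ s ∧ s < a (k + 1) := by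
    intro s
    by_cases hs : a 0 ≤ s
    · have hne : ∃ k, s < a (k + 1) :=
        (((tendsto_add_atTop_iff_nat 1).2 hat).eventually_gt_atTop s).exists
      classical
      refine ⟨Nat.find hne, fun _ => ⟨?_, Nat.find_spec hne⟩⟩
      rcases h : Nat.find hne with _ | k
      · exact hs
      · exact not_lt.1 (Nat.find_min hne (m := k) (by omega))
    · exact ⟨0, fun h => absurd h hs⟩
  choose idx hidx using hex
  set W : ℝ × M → N := blend c a idx (fun k => U (a k)) with hW
  have hWs : ∀ s x, S x + 1 < s → ContMDiffAt (𝓘(ℝ).prod (𝓡 m)) (𝓡 n) ∞ W (s, x) := by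
    intro s x hs
    refine hc.contMDiffAt_blend ha hidx (fun k => hu.1.1 _) (by linarith [hS2 x]) fun k h1 h2 => ?_
    -- Steps are at most `1`, so `S x + 1 < s ≤ a (k + 1)` places the earlier node above the
    -- threshold as well.
    have hk : S x < a k := by linarith [(hstep k).1]
    filter_upwards [hSs.continuous.continuousAt.eventually (gt_mem_nhds hk)] with x' hx'
    have hr := right_mem_Icc.2 (ha.monotone (Nat.le_succ k))
    exact ⟨fun t ht => (hgood k x' hx'.le t ht _ hr).1,
      (hgood k x' hx'.le 1 (right_mem_Icc.2 zero_le_one) _ hr).2.2⟩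
  -- A smooth modification of time that never enters the region where `W` may fail to be smooth.
  set θ : ℝ × M → ℝ := fun z => Real.smoothTransition (z.1 - S z.2 - 2) * z.1 +
    (1 - Real.smoothTransition (z.1 - S z.2 - 2)) * (S z.2 + 2) with hθ
  have hθs : ContMDiff (𝓘(ℝ).prod (𝓡 m)) 𝓘(ℝ) ∞ θ := by
    have c1 : ContMDiff (𝓘(ℝ).prod (𝓡 m)) 𝓘(ℝ) ∞ (fun z : ℝ × M => z.1) := contMDiff_fst
    have c2 : ContMDiff (𝓘(ℝ).prod (𝓡 m)) 𝓘(ℝ) ∞ (fun z : ℝ × M => S z.2) :=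
      hSs.comp contMDiff_snd
    have c3 : ContMDiff (𝓘(ℝ).prod (𝓡 m)) 𝓘(ℝ) ∞
        (fun z : ℝ × M => Real.smoothTransition (z.1 - S z.2 - 2)) :=
      (Real.smoothTransition.contDiff (n := ⊤)).contMDiff.comp ((c1.sub c2).sub contMDiff_const)
    exact (c3.mul c1).add ((contMDiff_const.sub c3).mul (c2.add contMDiff_const))
  have hθ1 : ∀ z : ℝ × M, S z.2 + 1 < θ z := by
    intro z
    rcases le_or_gt (z.1 - S z.2 - 2) 0 with h | h
    · simp only [hθ, Real.smoothTransition.zero_of_nonpos h]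
      linarith
    · have h1 := Real.smoothTransition.nonneg (z.1 - S z.2 - 2)
      have h2 := Real.smoothTransition.le_one (z.1 - S z.2 - 2)
      have h3 : θ z = S z.2 + 2 + Real.smoothTransition (z.1 - S z.2 - 2) * (z.1 - S z.2 - 2) := by
        simp only [hθ]
        ring
      rw [h3]
      nlinarith
  have hθ2 : ∀ z : ℝ × M, S z.2 + 3 ≤ z.1 → θ z = z.1 := by
    intro z hz
    simp only [hθ, Real.smoothTransition.one_of_one_le (show 1 ≤ z.1 - S z.2 - 2 by linarith)]
    ring
  have hWθ : ∀ s x, ContMDiffAt (𝓘(ℝ).prod (𝓡 m)) (𝓡 n) ∞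
      (fun z : ℝ × M => W (θ z, z.2)) (s, x) := fun s x =>
    (hWs _ _ (hθ1 (s, x))).comp (s, x) (f := fun z : ℝ × M => (θ z, z.2))
      (hθs.contMDiffAt.prodMk contMDiffAt_snd)
  have hinv : ∀ ε : Param, a 0 ≤ (ε : ℝ)⁻¹ := fun ε => by
    rw [ha0]
    exact (one_le_inv₀ ε.2.1).2 ε.2.2
  -- The nodes on either side of `1/ε` are at least `1` and differ by at most `1`, hence are within
  -- a factor `2` of `1/ε`.
  have hcomp : ∀ ε : Param, ∀ s : ℝ, 1 ≤ s → s ≤ 2 * (ε : ℝ)⁻¹ → (ε : ℝ)⁻¹ ≤ 2 * s →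
      (toParam s⁻¹ : ℝ) ≤ 2 * ε ∧ (ε : ℝ) ≤ 2 * (toParam s⁻¹ : ℝ) := by
    intro ε s hs h1 h2
    have h0 : 0 < (ε : ℝ) := ε.2.1
    have hs0 : 0 < s := by linarith
    rw [coe_toParam_inv hs]
    constructor
    · rw [inv_le_iff_one_le_mul₀ hs0]
      rw [inv_le_iff_one_le_mul₀ h0] at h2
      linarith
    · rw [← div_eq_mul_inv, le_div_iff₀ hs0]
      rw [← div_eq_mul_inv, le_div_iff₀ h0] at h1
      linarith
  refine ⟨fun ε x => W (θ ((ε : ℝ)⁻¹, x), x), fun ε => toParam (a (idx (ε : ℝ)⁻¹))⁻¹,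
    fun ε => toParam (a (idx (ε : ℝ)⁻¹ + 1))⁻¹,
    fun ε => transition (a (idx (ε : ℝ)⁻¹)) (a (idx (ε : ℝ)⁻¹ + 1)) (ε : ℝ)⁻¹,
    ?_, fun ε x => ?_, fun ε => ?_, fun ε => ?_, fun ε => ?_, fun ε => ?_,
    fun ε => transition_mem_Icc _ _ _, fun K hK => ?_⟩
  · rintro ⟨r, x⟩ ⟨hr, -⟩
    have h0 : ContMDiffAt (𝓘(ℝ, ℝ).prod (𝓡 m)) (𝓘(ℝ).prod (𝓡 m)) ∞
        (fun z : ℝ × M => (z.1⁻¹, z.2)) (r, x) := by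
      have h1 : ContMDiffAt 𝓘(ℝ) 𝓘(ℝ) ∞ (fun r : ℝ => r⁻¹) r :=
        (contDiffAt_inv ℝ hr.1.ne').contMDiffAt
      exact ContMDiffAt.prodMk (ContMDiffAt.comp (r, x) (f := fun z : ℝ × M => z.1) h1
        contMDiffAt_fst) contMDiffAt_snd
    have h2 := (hWθ r⁻¹ x).comp (r, x) (f := fun z : ℝ × M => (z.1⁻¹, z.2)) h0
    refine h2.contMDiffWithinAt.congr (fun z hz => ?_) ?_
    · have : (toParam z.1 : ℝ) = z.1 := congrArg Subtype.val (toParam_coe ⟨z.1, hz.1⟩)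
      simp only [this, Function.comp_apply]
    · have : (toParam r : ℝ) = r := congrArg Subtype.val (toParam_coe ⟨r, hr⟩)
      simp only [this, Function.comp_apply]
  · exact (hWθ (ε : ℝ)⁻¹ x).comp x (f := fun x : M => ((ε : ℝ)⁻¹, x))
      (contMDiffAt_const.prodMk contMDiffAt_id)
  · obtain ⟨h1, h2⟩ := hidx _ (hinv ε)
    exact (hcomp ε _ (ha1 _) (by linarith [ha1 (idx (ε : ℝ)⁻¹)])
      (by linarith [ha1 (idx (ε : ℝ)⁻¹), (hstep (idx (ε : ℝ)⁻¹)).1])).1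
  · obtain ⟨h1, h2⟩ := hidx _ (hinv ε)
    exact (hcomp ε _ (ha1 _) (by linarith [ha1 (idx (ε : ℝ)⁻¹)])
      (by linarith [ha1 (idx (ε : ℝ)⁻¹), (hstep (idx (ε : ℝ)⁻¹)).1])).2
  · obtain ⟨h1, h2⟩ := hidx _ (hinv ε)
    exact (hcomp ε _ (ha1 _) (by linarith [ha1 (idx (ε : ℝ)⁻¹), (hstep (idx (ε : ℝ)⁻¹)).1])
      (by linarith [ha1 (idx (ε : ℝ)⁻¹ + 1)])).1
  · obtain ⟨h1, h2⟩ := hidx _ (hinv ε)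
    exact (hcomp ε _ (ha1 _) (by linarith [ha1 (idx (ε : ℝ)⁻¹), (hstep (idx (ε : ℝ)⁻¹)).1])
      (by linarith [ha1 (idx (ε : ℝ)⁻¹ + 1)])).2
  -- `S` is bounded on `K`, so for small `ε` the time `1/ε` exceeds `S + 3` there and `θ` leaves it
  -- unchanged.
  · obtain ⟨R, hR⟩ := hK.exists_bound_of_continuousOn hSs.continuous.continuousOn
    have hR' : 0 < |R| + 3 := by positivity
    refine eventually_smallParam.2 ⟨(|R| + 3)⁻¹, by positivity, fun ε hε x hx => ?_⟩
    have hs : |R| + 3 < (ε : ℝ)⁻¹ := (lt_inv_comm₀ ε.2.1 hR').1 hε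
    have hSx : S x + 3 < (ε : ℝ)⁻¹ := by
      have h1 := hR x hx
      rw [Real.norm_eq_abs] at h1
      linarith [le_abs_self (S x), le_abs_self R]
    obtain ⟨h1, h2⟩ := hidx _ (hinv ε)
    set k := idx (ε : ℝ)⁻¹
    have hloc : ∀ x', S x' + 3 < (ε : ℝ)⁻¹ → W (θ ((ε : ℝ)⁻¹, x'), x') =
        c (transition (a k) (a (k + 1)) (ε : ℝ)⁻¹, U (a k) x', U (a (k + 1)) x') := by
      intro x' hx'
      rw [hθ2 ((ε : ℝ)⁻¹, x') hx'.le]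
      rfl
    have hst := hstep k
    have hSk : S x ≤ a k := by linarith
    have hkk : a k ≤ a (k + 1) := ha.monotone (Nat.le_succ k)
    -- With `j = ⌈a k⌉₊`, `1/ε < a (k + 1) ≤ a k + 1 ≤ j + 1`. The three memberships in `G j` are
    -- the step estimate with comparison time `1/ε`, with comparison time `a k`, and at `t = 0` with
    -- comparison time `a (k + 1)`.
    refine ⟨?_, ⌈a k⌉₊, by linarith [Nat.le_ceil (a k)], ?_, ?_, ?_⟩
    · filter_upwards [(hSs.continuous.add continuous_const).continuousAt.eventually
        (gt_mem_nhds hSx)] with x' hx'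
      exact hloc x' hx'
    · have := (hgood k x hSk _ (transition_mem_Icc (a k) (a (k + 1)) (ε : ℝ)⁻¹) (ε : ℝ)⁻¹
        ⟨h1, h2.le⟩).2.1
      rw [← hloc x hSx] at this
      simpa only [hU, inv_inv, toParam_coe] using this
    · have := (hgood k x hSk _ (transition_mem_Icc (a k) (a (k + 1)) (ε : ℝ)⁻¹) (a k)
        ⟨le_rfl, hkk⟩).2.1
      rwa [← hloc x hSx] at this
    · have := (hgood k x hSk 0 (left_mem_Icc.2 zero_le_one) (a (k + 1)) ⟨hkk, le_rfl⟩).2.1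
      rwa [hc.zero] at this

/-- The Riemannian distance induces the topology of `N`, so a small thickening of a compact set lies
in a larger compact set. -/
theorem UnifClose.isCBounded [IsManifold (𝓡 n) ∞ N] [T2Space N] {h : SmoothMetric n N}
    {u v : Param → M → N} (H : UnifClose h u v) (hv : IsCBounded v) : IsCBounded u := by
  have := Manifold.locallyCompact_of_finiteDimensional (M := N) (𝓡 n)
  let : Bundle.RiemannianBundle (fun x : N => TangentSpace (𝓡 n) x) := ⟨h.toRiemannianMetric⟩
  have : IsContinuousRiemannianBundle (EuclideanSpace ℝ (Fin n))
      (fun x : N => TangentSpace (𝓡 n) x) :=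
    ⟨⟨h.inner, h.contMDiff.continuous, fun _ _ _ => rfl⟩⟩
  let d : EMetricSpace N := EMetricSpace.ofRiemannianMetric (𝓡 n) N
  have hd : ∀ p q, riemDist h p q = edist p q := fun p q => rfl
  intro K hK
  obtain ⟨ε₀, h₀, K₁, hK₁, hvK⟩ := hv K hK
  obtain ⟨K₂, hK₂, hK₁₂⟩ := exists_compact_superset hK₁
  obtain ⟨δ, hδ, hδK⟩ := hK₁.exists_thickening_subset_open isOpen_interior hK₁₂
  obtain ⟨ε₁, h₁, H₁⟩ := H K hK (ENNReal.ofReal δ) (ENNReal.ofReal_pos.2 hδ)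
  refine ⟨min ε₀ ε₁, lt_min h₀ h₁, K₂, hK₂, fun ε hε x hx => interior_subset (hδK ?_)⟩
  rw [lt_min_iff] at hε
  rw [Metric.mem_thickening_iff_infEDist_lt]
  exact (Metric.infEDist_le_edist_of_mem (hvK ε hε.1 x hx)).trans_lt (H₁ ε hε.2 x hx)

/-- One term of the exponential series at `1/ε` suffices. This turns radii `exp (-j)` with `j ≥ 1/ε
- 1` into `O(ε^q)` for every `q`. -/
theorem exp_one_sub_inv_le (q : ℕ) (ε : Param) :
    Real.exp (1 - (ε : ℝ)⁻¹) ≤ Real.exp 1 * q.factorial * (ε : ℝ) ^ q := by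
  have hε : 0 < (ε : ℝ) := ε.2.1
  have h := Real.pow_div_factorial_le_exp (ε : ℝ)⁻¹ (by positivity) q
  rw [inv_pow, div_le_iff₀ (by positivity), inv_le_iff_one_le_mul₀ (by positivity)] at h
  rw [sub_eq_add_neg, Real.exp_add, Real.exp_neg, mul_assoc]
  gcongr
  rw [inv_le_iff_one_le_mul₀ (Real.exp_pos _)]
  linarith

theorem eventually_exp_one_sub_inv_lt {δ : ℝ} (hδ : 0 < δ) :
    ∀ᶠ ε : Param in smallParam, Real.exp (1 - (ε : ℝ)⁻¹) < δ := by
  filter_upwards [eventually_mul_pow_lt (Real.exp 1 * (Nat.factorial 1)) hδ one_ne_zero] with ε hε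
  exact (exp_one_sub_inv_le 1 ε).trans_lt hε

/-- The cut-off extends a chart continuously by zero to `N`, so closeness in that chart can be
imposed as a neighbourhood of the whole diagonal. -/
theorem continuous_smul_chart {e : OpenPartialHomeomorph N (EuclideanSpace ℝ (Fin n))} {η : N → ℝ}
    (hη : Continuous η) (hs : tsupport η ⊆ e.source) : Continuous fun p => η p • e p := by
  rw [continuous_iff_continuousAt]
  intro p
  by_cases hp : p ∈ e.source
  · exact hη.continuousAt.smul (e.continuousAt hp)
  · have hp' : p ∉ tsupport η := fun h => hp (hs h)
    refine continuousAt_const (y := (0 : EuclideanSpace ℝ (Fin n))) |>.congr ?_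
    filter_upwards [(isClosed_tsupport η).isOpen_compl.mem_nhds hp'] with q hq
    rw [image_eq_zero_of_notMem_tsupport hq, zero_smul]

/-- Transition maps are `C¹`, hence locally Lipschitz. Estimates in the fixed charts `e i` thus
carry over to an arbitrary chart `ψ`. -/
theorem exists_nhds_norm_chart_sub_le [IsManifold (𝓡 n) ∞ N]
    {e ψ : OpenPartialHomeomorph N (EuclideanSpace ℝ (Fin n))}
    (he : e ∈ IsManifold.maximalAtlas (𝓡 n) ∞ N) (hψ : ψ ∈ IsManifold.maximalAtlas (𝓡 n) ∞ N)
    {p : N} (hpe : p ∈ e.source) (hpψ : p ∈ ψ.source) :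
    ∃ C : ℝ, 0 ≤ C ∧ ∃ O ∈ 𝓝 p, ∀ a ∈ O, ∀ b ∈ O, ‖ψ a - ψ b‖ ≤ C * ‖e a - e b‖ := by
  have h := contDiffAt_chart (contMDiff_id (M := N)) he hψ hpe hpψ 1
  obtain ⟨C, t, ht, hC⟩ := ContDiffAt.exists_lipschitzOnWith (by exact_mod_cast h)
  refine ⟨C, C.2, e.source ∩ e ⁻¹' t, inter_mem (e.open_source.mem_nhds hpe)
    (e.continuousAt hpe ht), fun a ha b hb => ?_⟩
  have := hC.dist_le_mul _ ha.2 _ hb.2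
  simpa only [id, e.left_inv ha.1, e.left_inv hb.1, dist_eq_norm] using this

/-- Every c-bounded moderate net that is continuous in `ε` is equivalent to one that is smooth in
`(ε, x)`. -/
theorem exists_moderateNetsSm_netEquiv [IsManifold (𝓡 m) ∞ M] [T2Space M]
    [SecondCountableTopology M] [IsManifold (𝓡 n) ∞ N] [T2Space N] [SecondCountableTopology N]
    [Nonempty N] {u : Param → M → N} (hu : u ∈ moderateNetsCo m n M N) :
    ∃ g ∈ moderateNetsSm m n M N, NetEquiv m n g u := by
  have := Manifold.locallyCompact_of_finiteDimensional (M := N) (𝓡 n)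
  obtain ⟨h⟩ := nonempty_smoothMetric n N
  obtain ⟨hdc, hd0, -, -⟩ := riemDist_spec h
  obtain ⟨c, hc⟩ := exists_isInterpolation (n := n) (N := N)
  obtain ⟨e, η, he, hη, hs, -, h1⟩ := exists_bump_sequence (n := n) (N := N)
  set F : ℕ → N → EuclideanSpace ℝ (Fin n) := fun i p => η i p • e i p with hF
  have hFc : ∀ i, Continuous (F i) := fun i => continuous_smul_chart (hη i).continuous (hs i)
  -- Only the first `j` charts are constrained, which keeps `G j` a neighbourhood of the diagonal;
  -- each chart is eventually included as `j` grows.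
  set G : ℕ → Set (N × N) := fun j => {z | riemDist h z.1 z.2 < ENNReal.ofReal (Real.exp (-j)) ∧
    ∀ i ∈ Finset.range j, ‖F i z.1 - F i z.2‖ < Real.exp (-j)} with hGdef
  have hG : ∀ j p, G j ∈ 𝓝 (p, p) := by
    intro j p
    refine Filter.Eventually.and ?_ ((Finset.eventually_all _).2 fun i _ => ?_)
    · refine hdc.continuousAt.eventually (gt_mem_nhds ?_)
      simpa only [hd0] using ENNReal.ofReal_pos.2 (Real.exp_pos _)
    · have : Continuous fun z : N × N => ‖F i z.1 - F i z.2‖ :=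
        (((hFc i).comp continuous_fst).sub ((hFc i).comp continuous_snd)).norm
      refine this.continuousAt.eventually (gt_mem_nhds ?_)
      simpa using Real.exp_pos _
  obtain ⟨g, a, b, τ, hgs, hgx, ha, ha', hb, hb', hτ, hK⟩ := hc.exists_smooth_net hu hG
  have hexp : ∀ (ε : Param) (j : ℕ), (ε : ℝ)⁻¹ ≤ j + 1 →
      Real.exp (-j) ≤ Real.exp (1 - (ε : ℝ)⁻¹) := fun ε j hj => Real.exp_le_exp.2 (by linarith)
  have hclose : ∀ v w : Param → M → N, (∀ K : Set M, IsCompact K → ∀ᶠ ε : Param in smallParam,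
      ∀ x ∈ K, ∃ j : ℕ, (ε : ℝ)⁻¹ ≤ j + 1 ∧ (v ε x, w ε x) ∈ G j) → UnifClose h v w := by
    intro v w hvw K hK δ hδ
    obtain ⟨δ', hδ', hδδ⟩ := ENNReal.lt_iff_exists_real_btwn.1 hδ
    have hδ0 : 0 < δ' := ENNReal.ofReal_pos.1 hδδ.1
    refine eventually_smallParam.1 ?_
    filter_upwards [hvw K hK, eventually_exp_one_sub_inv_lt hδ0] with ε h1 h2 x hx
    obtain ⟨j, hj, hjG⟩ := h1 x hx
    exact hjG.1.trans_le ((ENNReal.ofReal_le_ofReal ((hexp ε j hj).trans h2.le)).trans hδδ.2.le)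
  have hA := comp_mem_moderateNets hu.1 ha ha'
  have hB := comp_mem_moderateNets hu.1 hb hb'
  have hgu : UnifClose h g u := hclose g u fun K hKc => (hK K hKc).mono fun ε H x hx => by
    obtain ⟨-, j, hj, h1, -, -⟩ := H x hx
    exact ⟨j, hj, h1⟩
  have hgA : UnifClose h g (fun ε => u (a ε)) :=
    hclose _ _ fun K hKc => (hK K hKc).mono fun ε H x hx => by
      obtain ⟨-, j, hj, -, h1, -⟩ := H x hx
      exact ⟨j, hj, h1⟩
  have hAB : UnifClose h (fun ε => u (a ε)) (fun ε => u (b ε)) :=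
    hclose _ _ fun K hKc => (hK K hKc).mono fun ε H x hx => by
      obtain ⟨-, j, hj, -, -, h1⟩ := H x hx
      exact ⟨j, hj, h1⟩
  -- c-boundedness has to come first: converting closeness in distance to neighbourhoods of the
  -- diagonal relies on it.
  have hgb : IsCBounded g := hgu.isCBounded hu.1.2.1
  have hgm : IsModerate m n g := hc.isModerate hA hB (hAB.eventuallyNear hA.2.1 hB.2.1)
    (hgA.eventuallyNear hgb hA.2.1) hτ fun K hKc => (hK K hKc).mono fun ε H x hx => (H x hx).1
  refine ⟨g, ⟨⟨hgx, hgb, hgm⟩, hgs⟩, ⟨h, hgu⟩,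
    isNegligibleDiff_of_order_zero hgm hgx hu.1.2.2 hu.1.1 ?_⟩
  intro q ψ hψ L hL L' hL' hLψ
  have hloc : ∀ p ∈ L', ∃ i : ℕ, ∃ C : ℝ, 0 ≤ C ∧ ∃ O : Set N, IsOpen O ∧ p ∈ O ∧
      ∀ x ∈ O, ∀ y ∈ O, ‖ψ x - ψ y‖ ≤ C * ‖F i x - F i y‖ := by
    intro p hp
    obtain ⟨i, hi⟩ := h1 p
    obtain ⟨C, hC, O, hO, hCO⟩ := exists_nhds_norm_chart_sub_le (he i) hψ
      (hs i (subset_tsupport _ (by simp [hi.self_of_nhds]))) (hLψ hp)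
    obtain ⟨O', hO's, hO'o, hpO'⟩ := mem_nhds_iff.1 (inter_mem hO hi)
    refine ⟨i, C, hC, O', hO'o, hpO', fun x hx y hy => ?_⟩
    have hx1 : η i x = 1 := (hO's hx).2
    have hy1 : η i y = 1 := (hO's hy).2
    simpa only [hF, hx1, hy1, one_smul] using hCO x (hO's hx).1 y (hO's hy).1
  choose! i C hC O hO hpO hCO using hloc
  obtain ⟨b, hbL, hb⟩ := hL'.elim_finite_subcover_image (b := L') (c := O) hO
    (fun p hp => mem_biUnion hp (hpO p hp))
  obtain ⟨hbf, hb⟩ := hb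
  have hnear := (hgu.eventuallyNear hgb hu.1.2.1) {z | z.1 ∈ L' → ∃ p ∈ b, z.1 ∈ O p ∧ z.2 ∈ O p}
    (mem_nhds_diagonal_of_compact (P := fun z => ∃ p ∈ b, z.1 ∈ O p ∧ z.2 ∈ O p) hL'
      fun p hp => by
        obtain ⟨p', hp'b, hp'⟩ := mem_iUnion₂.1 (hb hp)
        have hn := (hO p' (hbL hp'b)).mem_nhds hp'
        filter_upwards [prod_mem_nhds hn hn] with z hz
        exact ⟨p', hp'b, hz.1, hz.2⟩) L hL
  obtain ⟨I, hI⟩ := (hbf.image i).bddAbove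
  obtain ⟨C₀, hC₀⟩ := (hbf.image C).bddAbove
  -- Finitely many charts `e (i p)` cover `L'`, with indices at most `I` and Lipschitz constants at
  -- most `C₀`. Taking `ε < 1/(I + 2)` forces `j > I`, so all of these charts are controlled by `G
  -- j`.
  refine ⟨max C₀ 0 * (Real.exp 1 * q.factorial), ?_⟩
  filter_upwards [hnear, hK L hL,
    eventually_smallParam.2 ⟨((I : ℝ) + 2)⁻¹, by positivity, fun ε hε => hε⟩]
    with ε h2 h3 h4 x hx hgL huL
  obtain ⟨p, hpb, hgp, hup⟩ := h2 x hx hgL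
  obtain ⟨-, j, hj, hjG, -, -⟩ := h3 x hx
  have hIj : I < j := by
    have h5 : (I : ℝ) + 2 < (ε : ℝ)⁻¹ := (lt_inv_comm₀ ε.2.1 (by positivity)).1 h4
    have : (I : ℝ) < j := by linarith
    exact_mod_cast this
  have hip : i p ≤ I := hI ⟨p, hpb, rfl⟩
  have hCp : C p ≤ max C₀ 0 := (hC₀ ⟨p, hpb, rfl⟩).trans (le_max_left _ _)
  have h6 := hjG.2 (i p) (Finset.mem_range.2 (by omega))
  calc ‖ψ (g ε x) - ψ (u ε x)‖ ≤ C p * ‖F (i p) (g ε x) - F (i p) (u ε x)‖ :=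
        hCO p (hbL hpb) _ hgp _ hup
    _ ≤ max C₀ 0 * (Real.exp 1 * q.factorial * (ε : ℝ) ^ q) := by
        gcongr
        exact h6.le.trans ((hexp ε j hj).trans (exp_one_sub_inv_le q ε))
    _ = _ := by ring

end Construction

end GenFun

theorem mainTheorem3 (m n : ℕ) (M N : Type*)
    [TopologicalSpace M] [ChartedSpace (EuclideanSpace ℝ (Fin m)) M] [IsManifold (𝓡 m) ∞ M]
    [T2Space M] [SecondCountableTopology M]
    [TopologicalSpace N] [ChartedSpace (EuclideanSpace ℝ (Fin n)) N] [IsManifold (𝓡 n) ∞ N]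
    [T2Space N] [SecondCountableTopology N] :
    Function.Bijective (GenFun.tauSm m n M N) := by
  constructor
  · rintro ⟨u⟩ ⟨v⟩ h
    exact Quotient.sound (s := GenFun.netSetoid m n M N (GenFun.moderateNetsSm m n M N)
      fun _ hu => hu.1) (Quotient.exact (s := GenFun.netSetoid m n M N
        (GenFun.moderateNetsCo m n M N) fun _ hu => hu.1) h)
  · rintro ⟨u, hu⟩
    obtain ⟨g, hg, hgu⟩ : ∃ g ∈ GenFun.moderateNetsSm m n M N, GenFun.NetEquiv m n g u := by
      -- The interpolation needs a point of `N`, which `u` supplies when `M` is nonempty; for empty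
      -- `M` smoothness is vacuous and `u` itself serves.
      rcases isEmpty_or_nonempty M with hM | ⟨⟨x⟩⟩
      · exact ⟨u, ⟨hu.1, fun z => hM.elim z.2⟩, GenFun.netEquiv_refl u⟩
      · have : Nonempty N := ⟨u ⟨1, one_pos, le_rfl⟩ x⟩
        exact GenFun.exists_moderateNetsSm_netEquiv hu
    refine ⟨Quotient.mk (GenFun.netSetoid m n M N (GenFun.moderateNetsSm m n M N)
      fun _ hu => hu.1) ⟨g, hg⟩, ?_⟩
    exact Quotient.sound (s := GenFun.netSetoid m n M N (GenFun.moderateNetsCo m n M N)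
      fun _ hu => hu.1) hgu
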